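/- Let $d \ge 1$, let $S^d \subset \mathbb{R}^{d+1}$ be the unit sphere, and let $T = (T(x))_{x \in S^d}$ be a real Gaussian random field on a probability space $(\Omega, \mathcal{F}, \mathbb{P})$ with $\mathbb{E}[T(x)] = 0$ and $\mathrm{Var}(T(x)) = 1$ for every $x$. Suppose that $T$ is isotropic, i.e. for every $g \in \mathrm{SO}(d+1)$ and all $x_1, \dots, x_k \in S^d$ the vectors $(T(x_1), \dots, T(x_k))$ and $(T(gx_1), \dots, T(gx_k))$ have the same law. Suppose further that $T$ has Covariance Regularity Index (CRI) $\beta$ for some $\beta > 1$. This means that $\mathbb{E}[T(x)T(y)] = \kappa(\langle x, y\rangle)$ for all $x, y \in S^d$, with $\kappa$ continuous on $[-1,1]$ and of class $C^2$ on $(-1,1)$, and that one of the following holds: * $\beta = 2$ and $\kappa \in C^2([-1,1])$; * $\beta < 2$ and there are polynomials $p_1, p_{-1}$ and real constants $c_1, c_{-1}$ such that, as $t \to 0^+$, $$\kappa(1-t) = p_1(t) + c_1 t^\beta + o(t^\beta), \qquad \kappa(-1+t) = p_{-1}(t) + c_{-1} t^\beta + o(t^\beta),$$ and the first and second derivatives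 in $t$ of the two left-hand sides have the expansions obtained by differentiating these formally, with remainders $o(t^{\beta-1})$ and $o(t^{\beta-2})$ respectively. Then $T$ has $C^1$ sample paths in the following sense: 1. $T$ has a modification all of whose sample paths are in $C^1(S^d)$, i.e. there are random variables $S(x)$, $x \in S^d$, with $\mathbb{P}(S(x) = T(x)) = 1$ for every $x$, such that $x \mapsto S(x)(\omega)$ is in $C^1(S^d)$ for every $\omega \in \Omega$. 2. If $T$ is separable, i.e. there is a countable set $D \subset S^d$ such that for almost every $\omega$ and for every $x \in S^d$ the point $(x, T(x)(\omega))$ lies in the closure of $\{(y, T(y)(\omega)) : y \in D\}$ (in particular, if $T$ has almost surely continuous sample paths), then $T \in C^1(S^d)$ almost surely. -/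

import Mathlib

open MeasureTheory ProbabilityTheory Filter Topology Set Asymptotics
open scoped Manifold RealInnerProductSpace

/-- The unit sphere `S^d` in `ℝ^(d+1)`. -/
abbrev USphere (d : ℕ) : Type :=
  Metric.sphere (0 : EuclideanSpace ℝ (Fin (d + 1))) 1

/-- The action of a linear isometry of `ℝ^(d+1)` on the unit sphere. -/
noncomputable def sphereMap {d : ℕ}
    (g : EuclideanSpace ℝ (Fin (d + 1)) ≃ₗᵢ[ℝ] EuclideanSpace ℝ (Fin (d + 1)))
    (x : USphere d) : USphere d :=
  ⟨g x, by simp⟩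

/-- A random field on `S^d` is isotropic if its finite-dimensional distributions are invariant
under every rotation `g ∈ SO(d+1)`, that is, every linear isometry of determinant one. -/
def IsIsotropic {d : ℕ} {Ω : Type*} [MeasurableSpace Ω] (μ : Measure Ω)
    (T : USphere d → Ω → ℝ) : Prop :=
  ∀ g : EuclideanSpace ℝ (Fin (d + 1)) ≃ₗᵢ[ℝ] EuclideanSpace ℝ (Fin (d + 1)),
    LinearMap.det (g.toLinearEquiv : EuclideanSpace ℝ (Fin (d + 1)) →ₗ[ℝ]
      EuclideanSpace ℝ (Fin (d + 1))) = 1 →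
    ∀ (k : ℕ) (x : Fin k → USphere d),
      IdentDistrib (fun ω i => T (x i) ω) (fun ω i => T (sphereMap g (x i)) ω) μ μ

/-- `κ`, of which only the values on `[-1, 1]` matter, is the (continuous) covariance function of
the zero-mean isotropic field `T`: `E[T(x) T(y)] = κ(⟨x, y⟩)`. -/
structure IsCovarianceFunction {d : ℕ} {Ω : Type*} [MeasurableSpace Ω] (μ : Measure Ω)
    (T : USphere d → Ω → ℝ) (κ : ℝ → ℝ) : Prop where
  continuousOn : ContinuousOn κ (Icc (-1) 1)
  integral_mul : ∀ x y : USphere d,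
    ∫ ω, T x ω * T y ω ∂μ =
      κ ⟪(x : EuclideanSpace ℝ (Fin (d + 1))), (y : EuclideanSpace ℝ (Fin (d + 1)))⟫

/-- `g(t) = p(t) + c t^β + o(t^β)` as `t → 0+`, for a polynomial `p` and a constant `c`, and the
first two derivatives of `g` have the expansions obtained by differentiating this one. -/
def HasPowerExpansion (g : ℝ → ℝ) (β : ℝ) : Prop :=
  ∃ (p : Polynomial ℝ) (c : ℝ),
    (fun t => g t - (p.eval t + c * t ^ β)) =o[𝓝[>] 0] (fun t : ℝ => t ^ β) ∧
    (fun t => deriv g t - (p.derivative.eval t + c * β * t ^ (β - 1)))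
      =o[𝓝[>] 0] (fun t : ℝ => t ^ (β - 1)) ∧
    (fun t => deriv (deriv g) t -
        (p.derivative.derivative.eval t + c * β * (β - 1) * t ^ (β - 2)))
      =o[𝓝[>] 0] (fun t : ℝ => t ^ (β - 2))

/-- The field `T` has Covariance Regularity Index `β`. -/
def HasCRI {d : ℕ} {Ω : Type*} [MeasurableSpace Ω] (μ : Measure Ω)
    (T : USphere d → Ω → ℝ) (β : ℝ) : Prop :=
  ∃ κ : ℝ → ℝ, IsCovarianceFunction μ T κ ∧ ContDiffOn ℝ 2 κ (Ioo (-1) 1) ∧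
    ((β = 2 ∧ ContDiffOn ℝ 2 κ (Icc (-1) 1)) ∨
      (β < 2 ∧ HasPowerExpansion (fun t => κ (1 - t)) β ∧
        HasPowerExpansion (fun t => κ (-1 + t)) β))

/-- Separability of a random field in the sense of Doob: for some countable set `D`, almost every
sample path is determined by its restriction to `D`, in that its graph is contained in the closure
of the graph of the restriction. Every field on the sphere with almost surely continuous sample
paths is separable. -/
def IsSeparableField {d : ℕ} {Ω : Type*} [MeasurableSpace Ω] (μ : Measure Ω)
    (T : USphere d → Ω → ℝ) : Prop :=
  ∃ D : Set (USphere d), D.Countable ∧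
    ∀ᵐ ω ∂μ, ∀ x, (x, T x ω) ∈ closure ((fun y => (y, T y ω)) '' D)

/-- A real function on the sphere `S^d` is of class `C^1`. -/
def IsC1OnSphere {d : ℕ} (f : USphere d → ℝ) : Prop :=
  ContMDiff (𝓡 d) 𝓘(ℝ, ℝ) 1 f

/-! Extend the field to ℝ^(d+1) by X(y) = χ(y) T(y/‖y‖), with χ a smooth cutoff supported in an
annulus and equal to 1 on the sphere. Since 1 - ⟨u, v⟩ = ‖u - v‖²/2 on the sphere, the index
condition says that the covariance is an affine function of ⟨u, v⟩ up to an error O(‖u - v‖^(2β)).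
Let y be the barycentre of points at distance O(h), and consider X(y) minus the same barycentre of
the values of X. The affine part of the covariance sees only the barycentric errors of the C²
functions χ and χ(y) y/‖y‖. These are O(h²), so their squares are O(h⁴), and β ≤ 2. The variance is
therefore O(h^(2β)); this is `hasBarycentricBound_radialExtension`.

This second-order information is turned into C¹ paths by multiscale approximation, without
constructing derivatives of the field. Let Q_n be the quasi-interpolant with quadratic B-splines at
scale 2^(-n), whose coefficients are samples of X at the centres of the splines. Refinability makes
Q_(n+1) - Q_n a spline sum, and reproduction of affine functions makes each of its coefficients a
barycentric difference, Gaussian with standard deviation O(2^(-nβ)). High Gaussian moments absorb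
the O(2^(n(d+1))) nodes of each scale, so almost surely all coefficients are O(2^(-nγ)) with γ = (1
+ β)/2 > 1. A derivative costs a factor 2^n, so Q_n converges in C¹
(`exists_contDiff_tendsto_quasiInterp`). The L² bound identifies the limit with X at each point of
the closed unit ball, and restriction to the sphere gives the modification. A separable field
coincides almost surely with any continuous modification. -/

/-! ### The quadratic B-spline in one variable: affine reproduction and refinement. -/

/-- The square of the positive part. -/
noncomputable def posSq (x : ℝ) : ℝ := max x 0 ^ 2

theorem posSq_of_nonneg {x : ℝ} (hx : 0 ≤ x) : posSq x = x ^ 2 := by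
  rw [posSq, max_eq_left hx]

theorem posSq_of_nonpos {x : ℝ} (hx : x ≤ 0) : posSq x = 0 := by
  rw [posSq, max_eq_right hx]; norm_num

theorem posSq_two_mul (x : ℝ) : posSq (2 * x) = 4 * posSq x := by
  rcases le_total 0 x with hx | hx
  · rw [posSq_of_nonneg hx, posSq_of_nonneg (by linarith)]; ring
  · rw [posSq_of_nonpos hx, posSq_of_nonpos (by linarith)]; ring

theorem hasDerivAt_posSq (x : ℝ) : HasDerivAt posSq (2 * max x 0) x := by
  rcases lt_trichotomy x 0 with hx | rfl | hx
  · rw [max_eq_right hx.le, mul_zero]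
    refine (hasDerivAt_const x (0 : ℝ)).congr_of_eventuallyEq ?_
    filter_upwards [Iio_mem_nhds hx] with y hy using posSq_of_nonpos (le_of_lt hy)
  · rw [max_self, mul_zero, hasDerivAt_iff_isLittleO]
    have h : (fun y : ℝ => y ^ 2) =o[𝓝 0] fun y => y ^ 1 := isLittleO_pow_pow one_lt_two
    refine IsBigO.trans_isLittleO (IsBigO.of_bound 1 (Eventually.of_forall fun y => ?_))
      (by simpa using h)
    rw [posSq_of_nonneg le_rfl]
    have h0 : 0 ≤ max y 0 := le_max_right _ _
    have h1 : max y 0 ≤ |y| := max_le (le_abs_self y) (abs_nonneg y)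
    have h2 : max y 0 ^ 2 ≤ |y| ^ 2 := by gcongr
    simpa [posSq, abs_of_nonneg h0] using h2
  · rw [max_eq_left hx.le]
    have h := hasDerivAt_pow 2 x
    refine (h.congr_deriv (by simp)).congr_of_eventuallyEq ?_
    filter_upwards [Ioi_mem_nhds hx] with y hy using posSq_of_nonneg (le_of_lt hy)

theorem contDiff_posSq : ContDiff ℝ 1 posSq := by
  rw [contDiff_one_iff_deriv]
  refine ⟨fun x => (hasDerivAt_posSq x).differentiableAt, ?_⟩
  have h : deriv posSq = fun x => 2 * max x 0 := funext fun x => (hasDerivAt_posSq x).deriv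
  rw [h]
  fun_prop

/-- The cardinal quadratic B-spline, supported in `[0, 3]`. -/
noncomputable def quadSpline (x : ℝ) : ℝ :=
  (posSq x - 3 * posSq (x - 1) + 3 * posSq (x - 2) - posSq (x - 3)) / 2

/-- The refinement mask of the quadratic B-spline. -/
noncomputable def quadMask (k : ℤ) : ℝ :=
  if k = 0 then 1 / 4 else if k = 1 then 3 / 4 else if k = 2 then 3 / 4
    else if k = 3 then 1 / 4 else 0

theorem contDiff_quadSpline : ContDiff ℝ 1 quadSpline := by
  have h (c : ℝ) : ContDiff ℝ 1 fun x => posSq (x - c) :=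
    contDiff_posSq.comp (contDiff_id.sub contDiff_const)
  exact (((contDiff_posSq.sub (contDiff_const.mul (h 1))).add
    (contDiff_const.mul (h 2))).sub (h 3)).div_const 2

theorem quadSpline_of_nonpos {x : ℝ} (hx : x ≤ 0) : quadSpline x = 0 := by
  rw [quadSpline, posSq_of_nonpos hx, posSq_of_nonpos (by linarith), posSq_of_nonpos (by linarith),
    posSq_of_nonpos (by linarith)]
  norm_num

theorem quadSpline_of_three_le {x : ℝ} (hx : 3 ≤ x) : quadSpline x = 0 := by
  rw [quadSpline, posSq_of_nonneg (by linarith), posSq_of_nonneg (by linarith),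
    posSq_of_nonneg (by linarith), posSq_of_nonneg (by linarith)]
  ring

theorem quadSpline_of_mem_Icc_zero_one {x : ℝ} (h0 : 0 ≤ x) (h1 : x ≤ 1) :
    quadSpline x = x ^ 2 / 2 := by
  rw [quadSpline, posSq_of_nonneg h0, posSq_of_nonpos (by linarith), posSq_of_nonpos (by linarith),
    posSq_of_nonpos (by linarith)]
  ring

theorem quadSpline_of_mem_Icc_one_two {x : ℝ} (h0 : 1 ≤ x) (h1 : x ≤ 2) :
    quadSpline x = (x ^ 2 - 3 * (x - 1) ^ 2) / 2 := by
  rw [quadSpline, posSq_of_nonneg (by linarith), posSq_of_nonneg (by linarith),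
    posSq_of_nonpos (by linarith), posSq_of_nonpos (by linarith)]
  ring

theorem quadSpline_of_mem_Icc_two_three {x : ℝ} (h0 : 2 ≤ x) (h1 : x ≤ 3) :
    quadSpline x = (3 - x) ^ 2 / 2 := by
  rw [quadSpline, posSq_of_nonneg (by linarith), posSq_of_nonneg (by linarith),
    posSq_of_nonneg (by linarith), posSq_of_nonpos (by linarith)]
  ring

theorem quadSpline_nonneg (x : ℝ) : 0 ≤ quadSpline x := by
  rcases le_total x 0 with h0 | h0
  · rw [quadSpline_of_nonpos h0]
  rcases le_total x 1 with h1 | h1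
  · rw [quadSpline_of_mem_Icc_zero_one h0 h1]; positivity
  rcases le_total x 2 with h2 | h2
  · rw [quadSpline_of_mem_Icc_one_two h1 h2]; nlinarith
  rcases le_total x 3 with h3 | h3
  · rw [quadSpline_of_mem_Icc_two_three h2 h3]; positivity
  · rw [quadSpline_of_three_le h3]

theorem mem_Ioo_of_quadSpline_ne_zero {x : ℝ} (hx : quadSpline x ≠ 0) : x ∈ Ioo (0 : ℝ) 3 :=
  ⟨not_le.1 fun h => hx (quadSpline_of_nonpos h), not_le.1 fun h => hx (quadSpline_of_three_le h)⟩

theorem quadMask_nonneg (k : ℤ) : 0 ≤ quadMask k := by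
  unfold quadMask
  split_ifs <;> norm_num

theorem mem_Icc_of_quadMask_ne_zero {k : ℤ} (hk : quadMask k ≠ 0) : k ∈ Icc (0 : ℤ) 3 := by
  unfold quadMask at hk
  split_ifs at hk with h0 h1 h2 h3 <;> first | exact absurd rfl hk | (simp; lia)

/-- Only three translates are nonzero at a given point. Their explicit values reduce both the
partition of unity and affine reproduction to polynomial identities in the fractional part. -/
theorem sum_quadSpline_mul {x : ℝ} {I : Finset ℤ} (f : ℤ → ℝ)
    (hI : Finset.Icc (⌊x⌋ - 2) ⌊x⌋ ⊆ I) :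
    ∑ k ∈ I, quadSpline (x - k) * f k = Int.fract x ^ 2 / 2 * f ⌊x⌋ +
      ((Int.fract x + 1) ^ 2 - 3 * Int.fract x ^ 2) / 2 * f (⌊x⌋ - 1) +
      (1 - Int.fract x) ^ 2 / 2 * f (⌊x⌋ - 2) := by
  have h0 := Int.fract_nonneg x
  have h1 := (Int.fract_lt_one x).le
  have hx : x = Int.fract x + ⌊x⌋ := (Int.fract_add_floor x).symm
  rw [← Finset.sum_subset hI]
  · have hs : Finset.Icc (⌊x⌋ - 2) ⌊x⌋ = {⌊x⌋, ⌊x⌋ - 1, ⌊x⌋ - 2} := by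
      ext k; simp; lia
    have e0 : x - (⌊x⌋ : ℝ) = Int.fract x := rfl
    have e1 : x - ((⌊x⌋ - 1 : ℤ) : ℝ) = Int.fract x + 1 := by push_cast; linarith
    have e2 : x - ((⌊x⌋ - 2 : ℤ) : ℝ) = Int.fract x + 2 := by push_cast; linarith
    rw [hs, Finset.sum_insert (by simp; lia), Finset.sum_insert (by simp),
      Finset.sum_singleton, e0, e1, e2, quadSpline_of_mem_Icc_zero_one h0 h1,
      quadSpline_of_mem_Icc_one_two (by linarith) (by linarith),
      quadSpline_of_mem_Icc_two_three (by linarith) (by linarith)]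
    ring
  · intro k _ hk
    by_contra hne
    have hk' := mem_Ioo_of_quadSpline_ne_zero (left_ne_zero_of_mul hne)
    refine hk (Finset.mem_Icc.2 ⟨?_, Int.le_floor.2 (by linarith [hk'.1])⟩)
    have : (⌊x⌋ : ℝ) < k + 3 := by linarith [hk'.2, Int.floor_le x]
    have : ⌊x⌋ < k + 3 := by exact_mod_cast this
    lia

theorem sum_quadSpline {x : ℝ} {I : Finset ℤ} (hI : Finset.Icc (⌊x⌋ - 2) ⌊x⌋ ⊆ I) :
    ∑ k ∈ I, quadSpline (x - k) = 1 := by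
  have h := sum_quadSpline_mul (fun _ => 1) hI
  simp only [mul_one] at h
  rw [h]; ring

/-- The sampling point k + 3/2 is the centre of the support [k, k + 3]; sampling there is what makes
affine functions reproduce exactly. -/
theorem sum_quadSpline_mul_node {x : ℝ} {I : Finset ℤ} (hI : Finset.Icc (⌊x⌋ - 2) ⌊x⌋ ⊆ I) :
    ∑ k ∈ I, quadSpline (x - k) * ((k : ℝ) + 3 / 2) = x := by
  rw [sum_quadSpline_mul (fun k => (k : ℝ) + 3 / 2) hI]
  push_cast
  linear_combination (Int.fract_add_floor x)

/-- The mask has length four and j moves its argument by two, so just two values of j contribute. -/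
theorem sum_quadMask_mul {k : ℤ} {I : Finset ℤ} (f : ℤ → ℝ) (h0 : k / 2 ∈ I)
    (h1 : k / 2 - 1 ∈ I) :
    ∑ j ∈ I, quadMask (k - 2 * j) * f j =
      quadMask (k - 2 * (k / 2)) * f (k / 2) +
        quadMask (k - 2 * (k / 2 - 1)) * f (k / 2 - 1) := by
  have hI : ({k / 2, k / 2 - 1} : Finset ℤ) ⊆ I := by
    intro j hj
    simp only [Finset.mem_insert, Finset.mem_singleton] at hj
    rcases hj with rfl | rfl <;> assumption
  rw [← Finset.sum_subset hI, Finset.sum_pair (by lia)]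
  intro j _ hj
  by_contra hne
  have hk := mem_Icc_of_quadMask_ne_zero (left_ne_zero_of_mul hne)
  simp only [Finset.mem_insert, Finset.mem_singleton, mem_Icc] at hj hk
  lia

theorem sum_quadMask {k : ℤ} {I : Finset ℤ} (h0 : k / 2 ∈ I) (h1 : k / 2 - 1 ∈ I) :
    ∑ j ∈ I, quadMask (k - 2 * j) = 1 := by
  have h := sum_quadMask_mul (fun _ => 1) h0 h1
  simp only [mul_one] at h
  rw [h]
  rcases Int.emod_two_eq_zero_or_one k with hk | hk
  · rw [show k - 2 * (k / 2) = 0 by lia, show k - 2 * (k / 2 - 1) = 2 by lia]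
    norm_num [quadMask]
  · rw [show k - 2 * (k / 2) = 1 by lia, show k - 2 * (k / 2 - 1) = 3 by lia]
    norm_num [quadMask]

/-- Each fine node is thus a barycentre, with weights 1/4 and 3/4, of two neighbouring coarse nodes.
-/
theorem sum_quadMask_mul_node {k : ℤ} {I : Finset ℤ} (h0 : k / 2 ∈ I) (h1 : k / 2 - 1 ∈ I) :
    ∑ j ∈ I, quadMask (k - 2 * j) * ((j : ℝ) + 3 / 2) = ((k : ℝ) + 3 / 2) / 2 := by
  rw [sum_quadMask_mul (fun j => (j : ℝ) + 3 / 2) h0 h1]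
  rcases Int.emod_two_eq_zero_or_one k with hk | hk
  · have hk' : (k : ℝ) = 2 * ((k / 2 : ℤ) : ℝ) := by exact_mod_cast (by lia : k = 2 * (k / 2))
    rw [show k - 2 * (k / 2) = 0 by lia, show k - 2 * (k / 2 - 1) = 2 by lia]
    norm_num [quadMask]
    linarith
  · have hk' : (k : ℝ) = 2 * ((k / 2 : ℤ) : ℝ) + 1 := by
      exact_mod_cast (by lia : k = 2 * (k / 2) + 1)
    rw [show k - 2 * (k / 2) = 1 by lia, show k - 2 * (k / 2 - 1) = 3 by lia]
    norm_num [quadMask]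
    linarith

/-- With τ the unit shift, the spline is (1 - τ)³ applied to `posSq`, halved, and the mask is (1 +
τ)³ / 4. The two-scale relation is (1 + τ)³ (1 - τ)³ = (1 - τ²)³ together with the homogeneity of
`posSq`. -/
theorem sum_quadMask_mul_quadSpline {s : ℝ} {j : ℤ} {I : Finset ℤ}
    (hI : Finset.Icc (2 * j) (2 * j + 3) ⊆ I) :
    ∑ k ∈ I, quadMask (k - 2 * j) * quadSpline (2 * s - k) = quadSpline (s - j) := by
  rw [← Finset.sum_subset hI]
  · have hs : Finset.Icc (2 * j) (2 * j + 3) = {2 * j, 2 * j + 1, 2 * j + 2, 2 * j + 3} := by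
      ext k; simp; lia
    have e (c : ℝ) : posSq (2 * s - 2 * j - 2 * c) = 4 * posSq (s - j - c) := by
      rw [← posSq_two_mul]; ring_nf
    have e0 := e 0
    have e1 := e 1
    have e2 := e 2
    have e3 := e 3
    norm_num at e0 e1 e2 e3
    rw [hs, Finset.sum_insert (by simp), Finset.sum_insert (by simp),
      Finset.sum_insert (by simp), Finset.sum_singleton]
    simp only [quadSpline, quadMask]
    push_cast
    simp only [sub_self, add_sub_cancel_left, ← sub_sub]
    norm_num
    simp only [sub_sub (2 * s - 2 * (j : ℝ))]
    norm_num
    linear_combination e0 / 8 - 3 / 8 * e1 + 3 / 8 * e2 - 1 / 8 * e3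
  · intro k _ hk
    have : quadMask (k - 2 * j) = 0 := by
      by_contra hne
      have hk' := mem_Icc_of_quadMask_ne_zero hne
      simp only [Finset.mem_Icc, mem_Icc] at hk hk'
      lia
    rw [this, zero_mul]

/-! ### Tensor-product splines and bounds uniform in the scale. -/

section Tensor

variable {ι : Type*} [Fintype ι]

/-- The lattice point `k`, as a vector of the Euclidean space. -/
noncomputable def latticePoint (k : ι → ℤ) : EuclideanSpace ℝ ι := WithLp.toLp 2 fun i => (k i : ℝ)

/-- The centre of the B-spline of index `k` at scale `2 ^ (-n)`. -/
noncomputable def splineNode (n : ℕ) (k : ι → ℤ) : EuclideanSpace ℝ ι :=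
  WithLp.toLp 2 fun i => ((k i : ℝ) + 3 / 2) / 2 ^ n

/-- The tensor product quadratic B-spline, supported in `[0, 3]^ι`. -/
noncomputable def tensorSpline (z : EuclideanSpace ℝ ι) : ℝ := ∏ i, quadSpline (z i)

/-- The refinement mask of the tensor product quadratic B-spline. -/
noncomputable def tensorMask (k : ι → ℤ) : ℝ := ∏ i, quadMask (k i)

/-- The B-spline of index `k` at scale `2 ^ (-n)`. -/
noncomputable def splineAtom (n : ℕ) (k : ι → ℤ) (x : EuclideanSpace ℝ ι) : ℝ :=
  tensorSpline ((2 : ℝ) ^ n • x - latticePoint k)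

theorem splineAtom_eq (n : ℕ) (k : ι → ℤ) (x : EuclideanSpace ℝ ι) :
    splineAtom n k x = ∏ i, quadSpline (2 ^ n * x i - k i) := by
  simp [splineAtom, tensorSpline, latticePoint]

theorem splineAtom_nonneg (n : ℕ) (k : ι → ℤ) (x : EuclideanSpace ℝ ι) : 0 ≤ splineAtom n k x :=
  Finset.prod_nonneg fun _ _ => quadSpline_nonneg _

theorem tensorMask_nonneg (k : ι → ℤ) : 0 ≤ tensorMask k :=
  Finset.prod_nonneg fun _ _ => quadMask_nonneg _

theorem EuclideanSpace.norm_le_sqrt_card_mul {v : EuclideanSpace ℝ ι} {c : ℝ} (hc : 0 ≤ c)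
    (hv : ∀ i, |v i| ≤ c) : ‖v‖ ≤ √(Fintype.card ι) * c := by
  rw [EuclideanSpace.norm_eq, Real.sqrt_le_left (by positivity), mul_pow,
    Real.sq_sqrt (by positivity)]
  calc ∑ i, ‖v i‖ ^ 2 ≤ ∑ _i : ι, c ^ 2 :=
        Finset.sum_le_sum fun i _ => by rw [Real.norm_eq_abs]; gcongr; exact hv i
    _ = Fintype.card ι * c ^ 2 := by simp

theorem norm_splineNode_sub_le {n : ℕ} {j k : ι → ℤ} (h : tensorMask (k - 2 • j) ≠ 0) :
    ‖splineNode n j - splineNode (n + 1) k‖ ≤ √(Fintype.card ι) * 3 * (1 / 2) ^ n := by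
  rw [mul_assoc]
  refine EuclideanSpace.norm_le_sqrt_card_mul (by positivity) fun i => ?_
  have hi := mem_Icc_of_quadMask_ne_zero (Finset.prod_ne_zero_iff.1 h i (Finset.mem_univ i))
  simp only [Pi.sub_apply, nsmul_eq_mul, Nat.cast_ofNat, mem_Icc] at hi
  have h0 : (0 : ℝ) ≤ k i - 2 * j i := by exact_mod_cast hi.1
  have h3 : (k i - 2 * j i : ℝ) ≤ 3 := by exact_mod_cast hi.2
  have e : (splineNode n j - splineNode (n + 1) k : EuclideanSpace ℝ ι) i =
      ((3 / 4 : ℝ) - (k i - 2 * j i) / 2) * (1 / 2) ^ n := by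
    simp only [splineNode, PiLp.sub_apply, pow_succ, one_div, inv_pow]
    field_simp
    ring
  rw [e, abs_mul, abs_of_nonneg (by positivity : (0 : ℝ) ≤ (1 / 2) ^ n)]
  gcongr
  rw [abs_le]
  constructor <;> linarith

theorem norm_splineNode_sub_le_of_splineAtom_ne_zero {n : ℕ} {k : ι → ℤ}
    {x : EuclideanSpace ℝ ι} (h : splineAtom n k x ≠ 0) :
    ‖splineNode n k - x‖ ≤ √(Fintype.card ι) * 3 * (1 / 2) ^ n := by
  rw [mul_assoc]
  refine EuclideanSpace.norm_le_sqrt_card_mul (by positivity) fun i => ?_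
  rw [splineAtom_eq] at h
  have hi := mem_Ioo_of_quadSpline_ne_zero (Finset.prod_ne_zero_iff.1 h i (Finset.mem_univ i))
  have e : (splineNode n k - x : EuclideanSpace ℝ ι) i =
      ((3 / 2 : ℝ) - (2 ^ n * x i - k i)) * (1 / 2) ^ n := by
    simp only [splineNode, PiLp.sub_apply, one_div, inv_pow]
    field_simp
    ring
  rw [e, abs_mul, abs_of_nonneg (by positivity : (0 : ℝ) ≤ (1 / 2) ^ n)]
  gcongr
  rw [abs_le]
  constructor <;> linarith [hi.1, hi.2]

theorem contDiff_tensorSpline : ContDiff ℝ 1 (tensorSpline : EuclideanSpace ℝ ι → ℝ) := by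
  unfold tensorSpline
  refine contDiff_prod fun i _ => contDiff_quadSpline.comp ?_
  fun_prop

theorem contDiff_splineAtom (n : ℕ) (k : ι → ℤ) :
    ContDiff ℝ 1 (splineAtom n k : EuclideanSpace ℝ ι → ℝ) := by
  unfold splineAtom
  exact contDiff_tensorSpline.comp (by fun_prop)

theorem tsupport_tensorSpline_subset :
    tsupport (tensorSpline : EuclideanSpace ℝ ι → ℝ) ⊆ {z | ∀ i, z i ∈ Icc (0 : ℝ) 3} := by
  refine closure_minimal (fun z hz i => ?_) ?_
  · exact Ioo_subset_Icc_self
      (mem_Ioo_of_quadSpline_ne_zero (Finset.prod_ne_zero_iff.1 hz i (Finset.mem_univ i)))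
  · simp only [ofPred_forall]
    exact isClosed_iInter fun i => isClosed_Icc.preimage (by fun_prop)

theorem hasCompactSupport_tensorSpline :
    HasCompactSupport (tensorSpline : EuclideanSpace ℝ ι → ℝ) := by
  refine HasCompactSupport.of_support_subset_isCompact
    (isCompact_closedBall (0 : EuclideanSpace ℝ ι) (√(Fintype.card ι) * 3)) fun z hz => ?_
  rw [mem_closedBall_zero_iff]
  refine EuclideanSpace.norm_le_sqrt_card_mul (by norm_num) fun i => ?_
  have := tsupport_tensorSpline_subset (subset_tsupport _ hz) i
  rw [abs_of_nonneg this.1]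
  exact this.2

theorem exists_bound_tensorSpline : ∃ M : ℝ, 0 ≤ M ∧
    (∀ z : EuclideanSpace ℝ ι, ‖tensorSpline z‖ ≤ M) ∧
    ∀ z : EuclideanSpace ℝ ι, ‖fderiv ℝ tensorSpline z‖ ≤ M := by
  obtain ⟨M₀, h₀⟩ := (contDiff_tensorSpline (ι := ι)).continuous.bounded_above_of_compact_support
    hasCompactSupport_tensorSpline
  obtain ⟨M₁, h₁⟩ := ((contDiff_tensorSpline (ι := ι)).continuous_fderiv
    one_ne_zero).bounded_above_of_compact_support (hasCompactSupport_tensorSpline.fderiv ℝ)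
  exact ⟨max M₀ M₁, (norm_nonneg _).trans ((h₀ 0).trans (le_max_left _ _)),
    fun z => (h₀ z).trans (le_max_left _ _), fun z => (h₁ z).trans (le_max_right _ _)⟩

variable [DecidableEq ι]

/-- The lattice points in the cube `[-L, L]^ι`. -/
noncomputable def latticeBox (ι : Type*) [Fintype ι] [DecidableEq ι] (L : ℤ) : Finset (ι → ℤ) :=
  Fintype.piFinset fun _ => Finset.Icc (-L) L

/-- Absorbing f into the factor of index i₀ turns the sum into a product of one-dimensional sums,
all but one equal to 1. Affine reproduction passes to tensor products in this way, coordinate by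
coordinate. -/
theorem sum_piFinset_prod_mul (I : Finset ℤ) (w : ι → ℤ → ℝ) (hw : ∀ i, ∑ k ∈ I, w i k = 1)
    (i₀ : ι) (f : ℤ → ℝ) :
    ∑ k ∈ Fintype.piFinset fun _ => I, (∏ i, w i (k i)) * f (k i₀) =
      ∑ j ∈ I, w i₀ j * f j := by
  have h (k : ι → ℤ) : (∏ i, w i (k i)) * f (k i₀) =
      ∏ i, (w i (k i) * if i = i₀ then f (k i) else 1) := by
    rw [Finset.prod_mul_distrib, Finset.prod_ite_eq' Finset.univ i₀ fun i => f (k i)]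
    simp
  simp_rw [h]
  rw [← Finset.prod_univ_sum (fun _ : ι => I) fun i j => w i j * if i = i₀ then f j else 1,
    Finset.prod_eq_single i₀]
  · simp
  · intro i _ hi
    simp [hi, hw]
  · simp

theorem sum_piFinset_prod (I : Finset ℤ) (w : ι → ℤ → ℝ) (hw : ∀ i, ∑ k ∈ I, w i k = 1) :
    ∑ k ∈ Fintype.piFinset fun _ => I, ∏ i, w i (k i) = 1 := by
  rw [← Finset.prod_univ_sum]
  simp [hw]

theorem sum_tensorMask {L : ℤ} (hL : 2 ≤ L) {k : ι → ℤ} (hk : k ∈ latticeBox ι L) :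
    ∑ j ∈ latticeBox ι L, tensorMask (k - 2 • j) = 1 := by
  refine sum_piFinset_prod _ (fun i j => quadMask (k i - 2 * j)) fun i => ?_
  have := Fintype.mem_piFinset.1 hk i
  rw [Finset.mem_Icc] at this
  exact sum_quadMask (Finset.mem_Icc.2 (by lia)) (Finset.mem_Icc.2 (by lia))

theorem sum_tensorMask_smul_splineNode {L : ℤ} (hL : 2 ≤ L) {k : ι → ℤ}
    (hk : k ∈ latticeBox ι L) (n : ℕ) :
    ∑ j ∈ latticeBox ι L, tensorMask (k - 2 • j) • splineNode n j = splineNode (n + 1) k := by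
  have hm (i : ι) : k i / 2 ∈ Finset.Icc (-L) L ∧ k i / 2 - 1 ∈ Finset.Icc (-L) L := by
    have := Fintype.mem_piFinset.1 hk i
    rw [Finset.mem_Icc] at this
    exact ⟨Finset.mem_Icc.2 (by lia), Finset.mem_Icc.2 (by lia)⟩
  ext i
  have h := sum_piFinset_prod_mul (Finset.Icc (-L) L) (fun i j => quadMask (k i - 2 * j))
    (fun i => sum_quadMask (hm i).1 (hm i).2) i fun j => ((j : ℝ) + 3 / 2) / 2 ^ n
  have h' := sum_quadMask_mul_node (hm i).1 (hm i).2
  simp only [← mul_div_assoc, ← Finset.sum_div] at h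
  rw [h'] at h
  simp only [WithLp.ofLp_sum, Finset.sum_apply, WithLp.ofLp_smul, Pi.smul_apply, smul_eq_mul]
  simp only [splineNode, ← mul_div_assoc, ← Finset.sum_div]
  rw [pow_succ', ← div_div]
  exact h

theorem floor_Icc_subset {L : ℤ} {s : ℝ} (hs : |s| ≤ L - 3) :
    Finset.Icc (⌊s⌋ - 2) ⌊s⌋ ⊆ Finset.Icc (-L) L := by
  rw [abs_le] at hs
  have h1 : -(L - 3) ≤ ⌊s⌋ := Int.le_floor.2 (by push_cast; linarith)
  have h2 : ⌊s⌋ ≤ L - 3 := by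
    have : (⌊s⌋ : ℝ) ≤ ((L - 3 : ℤ) : ℝ) := by push_cast; linarith [Int.floor_le s]
    exact_mod_cast this
  exact Finset.Icc_subset_Icc (by lia) (by lia)

theorem sum_splineAtom {L : ℤ} {n : ℕ} {x : EuclideanSpace ℝ ι}
    (hx : ∀ i, |2 ^ n * x i| ≤ L - 3) : ∑ k ∈ latticeBox ι L, splineAtom n k x = 1 := by
  simp_rw [splineAtom_eq]
  exact sum_piFinset_prod _ (fun i k => quadSpline (2 ^ n * x i - k))
    fun i => sum_quadSpline (floor_Icc_subset (hx i))

theorem sum_splineAtom_smul_splineNode {L : ℤ} {n : ℕ} {x : EuclideanSpace ℝ ι}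
    (hx : ∀ i, |2 ^ n * x i| ≤ L - 3) :
    ∑ k ∈ latticeBox ι L, splineAtom n k x • splineNode n k = x := by
  simp_rw [splineAtom_eq]
  ext i
  have h := sum_piFinset_prod_mul (Finset.Icc (-L) L) (fun i k => quadSpline (2 ^ n * x i - k))
    (fun i => sum_quadSpline (floor_Icc_subset (hx i))) i fun j => ((j : ℝ) + 3 / 2) / 2 ^ n
  have h' := sum_quadSpline_mul_node (floor_Icc_subset (hx i))
  simp only [← mul_div_assoc, ← Finset.sum_div] at h
  rw [h', mul_div_cancel_left₀ _ (by positivity)] at h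
  simp only [WithLp.ofLp_sum, Finset.sum_apply, WithLp.ofLp_smul, Pi.smul_apply, smul_eq_mul]
  simp only [splineNode, ← mul_div_assoc, ← Finset.sum_div]
  exact h

theorem sum_tensorMask_mul_splineAtom {L : ℤ} {j : ι → ℤ} (hj : j ∈ latticeBox ι L) (n : ℕ)
    (x : EuclideanSpace ℝ ι) :
    ∑ k ∈ latticeBox ι (2 * L + 3), tensorMask (k - 2 • j) * splineAtom (n + 1) k x =
      splineAtom n j x := by
  simp_rw [splineAtom_eq, tensorMask, ← Finset.prod_mul_distrib, latticeBox, Pi.sub_apply]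
  rw [← Finset.prod_univ_sum (fun _ : ι => Finset.Icc (-(2 * L + 3)) (2 * L + 3)) fun i k =>
    quadMask (k - (2 • j) i) * quadSpline (2 ^ (n + 1) * x i - k)]
  refine Finset.prod_congr rfl fun i _ => ?_
  have hi := Fintype.mem_piFinset.1 hj i
  rw [Finset.mem_Icc] at hi
  have h := sum_quadMask_mul_quadSpline (s := 2 ^ n * x i) (j := j i)
    (I := Finset.Icc (-(2 * L + 3)) (2 * L + 3)) (Finset.Icc_subset_Icc (by lia) (by lia))
  rw [← h]
  refine Finset.sum_congr rfl fun k _ => ?_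
  simp only [Pi.smul_apply, nsmul_eq_mul, Nat.cast_ofNat]
  rw [pow_succ', mul_assoc]

/-- Finite overlap: four integers per coordinate cover all translates that are nonzero at z, so the
bound does not depend on the size of K. -/
theorem sum_abs_mul_norm_le {F : Type*} [NormedAddCommGroup F] {g : EuclideanSpace ℝ ι → F}
    {M δ : ℝ} (hM : ∀ z, ‖g z‖ ≤ M) (hg : ∀ z, g z ≠ 0 → ∀ i, z i ∈ Icc (0 : ℝ) 3)
    (K : Finset (ι → ℤ)) {a : (ι → ℤ) → ℝ} (hδ : 0 ≤ δ) (ha : ∀ k ∈ K, |a k| ≤ δ)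
    (z : EuclideanSpace ℝ ι) :
    ∑ k ∈ K, |a k| * ‖g (z - latticePoint k)‖ ≤ 4 ^ Fintype.card ι * (δ * M) := by
  have hM0 : 0 ≤ M := (norm_nonneg _).trans (hM 0)
  set P : Finset (ι → ℤ) := Fintype.piFinset fun i => Finset.Icc (⌊z i⌋ - 3) ⌊z i⌋ with hP
  have hcard : (P.card : ℝ) = 4 ^ Fintype.card ι := by
    rw [hP, Fintype.card_piFinset]
    have (i : ι) : (Finset.Icc (⌊z i⌋ - 3) ⌊z i⌋).card = 4 := by
      rw [Int.card_Icc]; lia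
    simp [this]
  calc ∑ k ∈ K, |a k| * ‖g (z - latticePoint k)‖
      = ∑ k ∈ K with k ∈ P, |a k| * ‖g (z - latticePoint k)‖ := by
        rw [Finset.sum_filter_of_ne]
        intro k _ hne
        have hk := hg _ (norm_ne_zero_iff.1 (right_ne_zero_of_mul hne))
        refine Fintype.mem_piFinset.2 fun i => ?_
        have hi := hk i
        simp only [latticePoint, PiLp.sub_apply, mem_Icc] at hi
        refine Finset.mem_Icc.2 ⟨?_, Int.le_floor.2 (by linarith)⟩
        have : (⌊z i⌋ : ℝ) ≤ ((k i + 3 : ℤ) : ℝ) := by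
          push_cast; linarith [Int.floor_le (z i)]
        have : ⌊z i⌋ ≤ k i + 3 := by exact_mod_cast this
        lia
    _ ≤ ∑ k ∈ K with k ∈ P, δ * M := by
        refine Finset.sum_le_sum fun k hk => ?_
        exact mul_le_mul (ha k (Finset.mem_filter.1 hk).1) (hM _) (norm_nonneg _) hδ
    _ = (K.filter (· ∈ P)).card * (δ * M) := by simp
    _ ≤ P.card * (δ * M) := by
        gcongr
        exact fun k hk => (Finset.mem_filter.1 hk).2
    _ = _ := by rw [hcard]

/-- A Bernstein inequality: by finite overlap the sup norm is controlled by the largest coefficient,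
and a derivative costs one factor 2^n from the dilation. -/
theorem exists_bound_sum_splineAtom (ι : Type*) [Fintype ι] [DecidableEq ι] :
    ∃ M : ℝ, 0 ≤ M ∧ ∀ (n : ℕ) (K : Finset (ι → ℤ))
    (a : (ι → ℤ) → ℝ) (δ : ℝ), 0 ≤ δ → (∀ k ∈ K, |a k| ≤ δ) → ∀ x : EuclideanSpace ℝ ι,
      ‖∑ k ∈ K, a k * splineAtom n k x‖ ≤ M * δ ∧
      ‖fderiv ℝ (fun y => ∑ k ∈ K, a k * splineAtom n k y) x‖ ≤ M * 2 ^ n * δ := by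
  obtain ⟨M, hM0, hM, hM'⟩ := exists_bound_tensorSpline (ι := ι)
  refine ⟨4 ^ Fintype.card ι * M, by positivity, fun n K a δ hδ ha x => ⟨?_, ?_⟩⟩
  · calc ‖∑ k ∈ K, a k * splineAtom n k x‖
        ≤ ∑ k ∈ K, |a k| * ‖tensorSpline ((2 : ℝ) ^ n • x - latticePoint k)‖ :=
          (norm_sum_le _ _).trans_eq (Finset.sum_congr rfl fun k _ => norm_mul _ _)
      _ ≤ 4 ^ Fintype.card ι * (δ * M) :=
          sum_abs_mul_norm_le hM
            (fun z hz => tsupport_tensorSpline_subset (subset_tsupport _ hz)) K hδ ha _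
      _ = _ := by ring
  · have hd (k : ι → ℤ) : HasFDerivAt (fun y => a k * splineAtom n k y)
        (a k • (2 : ℝ) ^ n • fderiv ℝ tensorSpline ((2 : ℝ) ^ n • x - latticePoint k)) x := by
      refine HasFDerivAt.const_mul ?_ (a k)
      have h1 : HasFDerivAt (fun y : EuclideanSpace ℝ ι => (2 : ℝ) ^ n • y - latticePoint k)
          ((2 : ℝ) ^ n • ContinuousLinearMap.id ℝ _) x :=
        HasFDerivAt.sub_const _ ((hasFDerivAt_id x).fun_const_smul _)
      have h2 := ((contDiff_tensorSpline (ι := ι)).differentiable one_ne_zero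
        ((2 : ℝ) ^ n • x - latticePoint k)).hasFDerivAt
      have h3 := h2.comp x h1
      refine h3.congr_fderiv ?_
      ext v
      simp
    rw [(HasFDerivAt.fun_sum fun k _ => hd k).fderiv]
    calc ‖∑ k ∈ K, a k • (2 : ℝ) ^ n • fderiv ℝ tensorSpline ((2 : ℝ) ^ n • x - latticePoint k)‖
        ≤ ∑ k ∈ K, 2 ^ n * (|a k| *
            ‖fderiv ℝ tensorSpline ((2 : ℝ) ^ n • x - latticePoint k)‖) := by
          refine (norm_sum_le _ _).trans_eq (Finset.sum_congr rfl fun k _ => ?_)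
          rw [norm_smul, norm_smul, Real.norm_eq_abs, norm_pow, Real.norm_ofNat]
          ring
      _ = 2 ^ n * ∑ k ∈ K, (|a k| *
            ‖fderiv ℝ tensorSpline ((2 : ℝ) ^ n • x - latticePoint k)‖) := by
          rw [Finset.mul_sum]
      _ ≤ 2 ^ n * (4 ^ Fintype.card ι * (δ * M)) := by
          gcongr
          exact sum_abs_mul_norm_le hM'
            (fun z hz => tsupport_tensorSpline_subset (support_fderiv_subset ℝ hz)) K hδ ha _
      _ = _ := by ring

end Tensor

/-! ### Quasi-interpolants and their C¹ convergence. -/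

section QuasiInterpolant

variable {ι : Type*} [Fintype ι] [DecidableEq ι]

/-- Half the side of the cube of lattice points used at scale `2 ^ (-n)`. -/
def boxSize (n : ℕ) : ℤ := 2 ^ (n + 3) - 3

/-- The offset -3 makes each box exactly the one needed to refine the atoms of the previous box. -/
theorem boxSize_succ (n : ℕ) : boxSize (n + 1) = 2 * boxSize n + 3 := by
  simp only [boxSize]; ring

theorem boxSize_cast (n : ℕ) : (boxSize n : ℝ) = 8 * 2 ^ n - 3 := by
  simp only [boxSize]; push_cast; ring

theorem five_le_boxSize (n : ℕ) : 5 ≤ boxSize n := by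
  have : (1 : ℤ) ≤ 2 ^ n := one_le_pow₀ (by norm_num)
  simp only [boxSize, pow_add]; lia

/-- The spline quasi-interpolant of `f` at scale `2 ^ (-n)`. -/
noncomputable def quasiInterp (f : EuclideanSpace ℝ ι → ℝ) (n : ℕ) (x : EuclideanSpace ℝ ι) : ℝ :=
  ∑ k ∈ latticeBox ι (boxSize n), f (splineNode n k) * splineAtom n k x

/-- The coefficients of the difference of two successive quasi-interpolants of `f`. -/
noncomputable def splineDetail (f : EuclideanSpace ℝ ι → ℝ) (n : ℕ) (k : ι → ℤ) : ℝ :=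
  f (splineNode (n + 1) k) -
    ∑ j ∈ latticeBox ι (boxSize (n + 1)), tensorMask (k - 2 • j) * f (splineNode n j)

/-- Truncating to the box therefore loses no sample of a function vanishing outside the ball of
radius 2. -/
theorem two_lt_norm_splineNode {n : ℕ} {k : ι → ℤ} (hk : k ∉ latticeBox ι (boxSize n)) :
    2 < ‖(splineNode n k : EuclideanSpace ℝ ι)‖ := by
  obtain ⟨i, hi⟩ : ∃ i, k i ∉ Finset.Icc (-boxSize n) (boxSize n) := by
    simpa [latticeBox, Fintype.mem_piFinset] using hk
  have h1 : (1 : ℝ) ≤ 2 ^ n := one_le_pow₀ (by norm_num)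
  have h2 : 2 * 2 ^ n < |(k i : ℝ) + 3 / 2| := by
    rw [lt_abs]
    have hb := boxSize_cast n
    rcases lt_or_ge (k i) (-boxSize n) with h | h
    · right
      have : (k i : ℝ) + 1 ≤ -boxSize n := by exact_mod_cast h
      linarith
    · left
      have h' : boxSize n < k i := not_le.1 fun h' => hi (Finset.mem_Icc.2 ⟨h, h'⟩)
      have : (boxSize n : ℝ) + 1 ≤ k i := by exact_mod_cast h'
      linarith
  refine lt_of_lt_of_le ?_ (PiLp.norm_apply_le (splineNode n k) i)
  simp only [splineNode, norm_div, Real.norm_eq_abs, norm_pow, abs_two]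
  rwa [lt_div_iff₀ (by positivity)]

/-- Refining the coarse atoms puts both quasi-interpolants on the fine grid, where their
coefficients can be subtracted. -/
theorem quasiInterp_succ_sub {f : EuclideanSpace ℝ ι → ℝ} (hf : ∀ y, 2 < ‖y‖ → f y = 0) (n : ℕ)
    (x : EuclideanSpace ℝ ι) :
    quasiInterp f (n + 1) x - quasiInterp f n x =
      ∑ k ∈ latticeBox ι (boxSize (n + 1)), splineDetail f n k * splineAtom (n + 1) k x := by
  have hsub : latticeBox ι (boxSize n) ⊆ latticeBox ι (boxSize (n + 1)) := by
    have := five_le_boxSize n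
    refine Fintype.piFinset_subset _ _ fun i => Finset.Icc_subset_Icc ?_ ?_ <;>
      rw [boxSize_succ] <;> lia
  have h : quasiInterp f n x = ∑ k ∈ latticeBox ι (boxSize (n + 1)),
      (∑ j ∈ latticeBox ι (boxSize (n + 1)), tensorMask (k - 2 • j) * f (splineNode n j)) *
        splineAtom (n + 1) k x := by
    simp_rw [Finset.sum_mul]
    rw [Finset.sum_comm, ← Finset.sum_subset hsub]
    · refine Finset.sum_congr rfl fun j hj => ?_
      rw [← sum_tensorMask_mul_splineAtom hj n x, ← boxSize_succ, Finset.mul_sum]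
      exact Finset.sum_congr rfl fun k _ => by ring
    · intro j _ hj
      simp [hf _ (two_lt_norm_splineNode hj)]
  rw [h, quasiInterp, ← Finset.sum_sub_distrib]
  exact Finset.sum_congr rfl fun k _ => by rw [splineDetail]; ring

theorem contDiff_quasiInterp (f : EuclideanSpace ℝ ι → ℝ) (n : ℕ) :
    ContDiff ℝ 1 (quasiInterp f n) :=
  ContDiff.sum fun k _ => contDiff_const.mul (contDiff_splineAtom n k)

/-- Spline quasi-interpolants whose details decay like `2 ^ (-γ n)`, with `γ > 1`, converge to a
function of class `C^1`. -/
theorem exists_contDiff_tendsto_quasiInterp {f : EuclideanSpace ℝ ι → ℝ}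
    (hf : ∀ y, 2 < ‖y‖ → f y = 0) {γ W : ℝ} (hγ : 1 < γ) (hW : 0 ≤ W)
    (hD : ∀ n, ∀ k ∈ latticeBox ι (boxSize (n + 1)),
      |splineDetail f n k| ≤ W * ((1 / 2 : ℝ) ^ n) ^ γ) :
    ∃ g : EuclideanSpace ℝ ι → ℝ, ContDiff ℝ 1 g ∧
      ∀ x, Tendsto (fun n => quasiInterp f n x) atTop (𝓝 (g x)) := by
  obtain ⟨M, hM0, hM⟩ := exists_bound_sum_splineAtom ι
  set r : ℕ → EuclideanSpace ℝ ι → ℝ := fun n x =>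
    ∑ k ∈ latticeBox ι (boxSize (n + 1)), splineDetail f n k * splineAtom (n + 1) k x with hr
  have hr1 (n : ℕ) : ContDiff ℝ 1 (r n) :=
    ContDiff.sum fun k _ => contDiff_const.mul (contDiff_splineAtom _ k)
  set q : ℝ := (1 / 2 : ℝ) ^ (γ - 1) with hq
  have hq0 : 0 ≤ q := by positivity
  have hq1 : q < 1 := Real.rpow_lt_one (by norm_num) (by norm_num) (by linarith)
  -- The factor 2^(-n) pays for one derivative; the remaining q^n is summable because γ > 1.
  have hpow (n : ℕ) : ((1 / 2 : ℝ) ^ n) ^ γ = (1 / 2) ^ n * q ^ n := by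
    rw [hq, ← Real.rpow_mul_natCast (by norm_num), ← Real.rpow_natCast, ← Real.rpow_mul (by norm_num),
      ← Real.rpow_add (by norm_num)]
    ring_nf
  have hsum : Summable fun n : ℕ => 2 * M * W * q ^ n :=
    (summable_geometric_of_lt_one hq0 hq1).mul_left _
  have hb (n : ℕ) (x : EuclideanSpace ℝ ι) :
      ‖r n x‖ ≤ 2 * M * W * q ^ n ∧ ‖fderiv ℝ (r n) x‖ ≤ 2 * M * W * q ^ n := by
    obtain ⟨h0, h1⟩ := hM (n + 1) (latticeBox ι (boxSize (n + 1))) (splineDetail f n)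
      (W * ((1 / 2 : ℝ) ^ n) ^ γ) (by positivity) (hD n) x
    rw [hpow] at h0 h1
    constructor
    · refine h0.trans ?_
      have h2 : (1 / 2 : ℝ) ^ n ≤ 1 := pow_le_one₀ (by norm_num) (by norm_num)
      calc M * (W * ((1 / 2) ^ n * q ^ n)) ≤ M * (W * (1 * q ^ n)) := by gcongr
        _ ≤ 2 * M * W * q ^ n := by
          have : 0 ≤ M * W * q ^ n := by positivity
          linarith
    · refine h1.trans_eq ?_
      have : (2 : ℝ) ^ n * (1 / 2) ^ n = 1 := by rw [← mul_pow]; norm_num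
      rw [pow_succ]
      linear_combination (2 * M * W * q ^ n) * this
  have hS (x : EuclideanSpace ℝ ι) : Summable fun n => r n x :=
    Summable.of_norm_bounded hsum fun n => (hb n x).1
  refine ⟨fun x => quasiInterp f 0 x + ∑' n, r n x, (contDiff_quasiInterp f 0).add ?_, fun x => ?_⟩
  · refine contDiff_tsum (𝕜 := ℝ) (N := 1) (v := fun _ n => 2 * M * W * q ^ n) hr1
      (fun _ _ => hsum) fun k n x hk => ?_
    have hk' : k ≤ 1 := by exact_mod_cast hk
    interval_cases k
    · rw [norm_iteratedFDeriv_zero]; exact (hb n x).1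
    · rw [norm_iteratedFDeriv_one]; exact (hb n x).2
  · refine ((hS x).hasSum.tendsto_sum_nat.const_add (quasiInterp f 0 x)).congr fun n => ?_
    have : ∀ i, r i x = quasiInterp f (i + 1) x - quasiInterp f i x :=
      fun i => (quasiInterp_succ_sub hf i x).symm
    simp_rw [this]
    rw [Finset.sum_range_sub fun i => quasiInterp f i x]
    ring

end QuasiInterpolant

/-! ### From barycentric L² bounds to C¹ modifications of Gaussian fields. -/

section GaussianModification

variable {ι : Type*} [Fintype ι] {Ω : Type*} [MeasurableSpace Ω] {μ : Measure Ω}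

/-- The even moments of centred Gaussian variables are controlled by their variance. -/
theorem exists_lintegral_pow_le_of_hasGaussianLaw (μ : Measure Ω) (m : ℕ) :
    ∃ c : ENNReal, c ≠ ⊤ ∧ ∀ (Y : Ω → ℝ) (v : ℝ), HasGaussianLaw Y μ → ∫ ω, Y ω ∂μ = 0 →
      ∫ ω, Y ω ^ 2 ∂μ ≤ v →
      ∫⁻ ω, ENNReal.ofReal (Y ω ^ (2 * m)) ∂μ ≤ c * ENNReal.ofReal (v ^ m) := by
  refine ⟨∫⁻ x, ENNReal.ofReal (x ^ (2 * m)) ∂gaussianReal 0 1, ?_, ?_⟩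
  · have h : Integrable (fun x : ℝ => x ^ (2 * m)) (gaussianReal 0 1) := by
      have := (memLp_id_gaussianReal' (μ := 0) (v := 1) ((2 * m : ℕ) : ENNReal)
        (ENNReal.natCast_ne_top _)).integrable_norm_pow'
      simpa [Even.pow_abs (even_two_mul m)] using this
    exact h.lintegral_lt_top.ne
  · intro Y v hY h0 hv
    set σ : ℝ := √Var[Y; μ] with hσ
    -- Writing the law as that of σ times a standard normal covers the degenerate case σ = 0.
    have hmap : μ.map Y = (gaussianReal 0 1).map (σ * ·) := by
      rw [hY.map_eq_gaussianReal, h0, gaussianReal_map_const_mul, mul_zero, mul_one]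
      congr 1
      ext
      simp [hσ, Real.sq_sqrt (variance_nonneg Y μ), variance_nonneg Y μ]
    have hvar : σ ^ 2 ≤ v := by
      rw [hσ, Real.sq_sqrt (variance_nonneg Y μ), variance_of_integral_eq_zero hY.aemeasurable h0]
      exact hv
    have hmeas : Measurable fun x : ℝ => ENNReal.ofReal (x ^ (2 * m)) := by fun_prop
    calc ∫⁻ ω, ENNReal.ofReal (Y ω ^ (2 * m)) ∂μ
        = ∫⁻ x, ENNReal.ofReal (x ^ (2 * m)) ∂(μ.map Y) :=
          (lintegral_map' hmeas.aemeasurable hY.aemeasurable).symm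
      _ = ∫⁻ x, ENNReal.ofReal ((σ * x) ^ (2 * m)) ∂gaussianReal 0 1 := by
          rw [hmap, lintegral_map hmeas (by fun_prop)]
      _ = (∫⁻ x, ENNReal.ofReal (x ^ (2 * m)) ∂gaussianReal 0 1) *
            ENNReal.ofReal ((σ ^ 2) ^ m) := by
          rw [← lintegral_mul_const _ hmeas]
          refine lintegral_congr fun x => ?_
          rw [mul_pow, ← pow_mul, mul_comm, ENNReal.ofReal_mul]
          rw [pow_mul]; positivity
      _ ≤ _ := by gcongr

theorem hasGaussianLaw_sub_sum {E κ : Type*} {X : E → Ω → ℝ} (hX : IsGaussianProcess X μ)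
    (s : Finset κ) (w : κ → ℝ) (p : κ → E) (y : E) :
    HasGaussianLaw (fun ω => X y ω - ∑ i ∈ s, w i * X (p i) ω) μ := by
  have h := ((hX.comp_right fun o : Option κ => o.elim y p).smul
    fun o => o.elim 1 fun i => -w i).hasGaussianLaw_fun_sum (I := Finset.insertNone s)
  simpa [Finset.sum_insertNone, sub_eq_add_neg] using h

theorem integral_sub_sum_eq_zero {E κ : Type*} {X : E → Ω → ℝ} (hX : IsGaussianProcess X μ)
    (h0 : ∀ x, ∫ ω, X x ω ∂μ = 0) (s : Finset κ) (w : κ → ℝ) (p : κ → E) (y : E) :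
    ∫ ω, (X y ω - ∑ i ∈ s, w i * X (p i) ω) ∂μ = 0 := by
  have hi (x : E) : Integrable (X x) μ := (hX.hasGaussianLaw_eval x).integrable
  rw [integral_sub (hi y) (integrable_finsetSum _ fun i _ => (hi (p i)).const_mul _),
    integral_finsetSum _ fun i _ => (hi (p i)).const_mul _]
  simp [integral_const_mul, h0]

/-- Replacing the value of the field at a barycentre, at scale `h`, by the barycentre of its values
produces an `L²` error `O(h ^ β)`. -/
def HasBarycentricBound (μ : Measure Ω) (X : EuclideanSpace ℝ ι → Ω → ℝ) (β : ℝ) : Prop :=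
  ∀ ρ : ℝ, 0 ≤ ρ → ∃ C : ℝ, 0 ≤ C ∧ ∀ h : ℝ, 0 < h → h ≤ 1 →
    ∀ (s : Finset (ι → ℤ)) (w : (ι → ℤ) → ℝ) (p : (ι → ℤ) → EuclideanSpace ℝ ι)
      (y : EuclideanSpace ℝ ι), (∀ i ∈ s, 0 ≤ w i) → ∑ i ∈ s, w i = 1 → ∑ i ∈ s, w i • p i = y →
      (∀ i ∈ s, w i ≠ 0 → ‖p i - y‖ ≤ ρ * h) →
      ∫ ω, (X y ω - ∑ i ∈ s, w i * X (p i) ω) ^ 2 ∂μ ≤ C * h ^ (2 * β)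

end GaussianModification

section GaussianModification

variable {ι : Type*} [Fintype ι] [DecidableEq ι] {Ω : Type*} [MeasurableSpace Ω] {μ : Measure Ω}
  {X : EuclideanSpace ℝ ι → Ω → ℝ} {β : ℝ}

/-- A detail is the value at a fine node minus the mask-weighted mean of coarse samples, and the
mask reproduces the fine node. -/
theorem HasBarycentricBound.exists_integral_splineDetail_sq_le (hB : HasBarycentricBound μ X β) :
    ∃ C : ℝ, 0 ≤ C ∧ ∀ n, ∀ k ∈ latticeBox ι (boxSize (n + 1)),
      ∫ ω, splineDetail (fun y => X y ω) n k ^ 2 ∂μ ≤ C * ((1 / 2 : ℝ) ^ n) ^ (2 * β) := by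
  obtain ⟨C, hC0, hC⟩ := hB (√(Fintype.card ι) * 3) (by positivity)
  refine ⟨C, hC0, fun n k hk => ?_⟩
  have hL : 2 ≤ boxSize (n + 1) := by linarith [five_le_boxSize (n + 1)]
  exact hC ((1 / 2) ^ n) (by positivity) (pow_le_one₀ (by norm_num) (by norm_num)) _
    (fun j => tensorMask (k - 2 • j)) (splineNode n) (splineNode (n + 1) k)
    (fun _ _ => tensorMask_nonneg _) (sum_tensorMask hL hk)
    (sum_tensorMask_smul_splineNode hL hk n) fun j _ hj => norm_splineNode_sub_le hj

/-- The atoms evaluated at y are themselves barycentric weights on the nodes; ‖y‖ ≤ 1 ensures that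
the box contains every atom that matters. -/
theorem HasBarycentricBound.exists_integral_quasiInterp_sub_sq_le
    (hB : HasBarycentricBound μ X β) :
    ∃ C : ℝ, 0 ≤ C ∧ ∀ y : EuclideanSpace ℝ ι, ‖y‖ ≤ 1 → ∀ n,
      ∫ ω, (X y ω - quasiInterp (fun y => X y ω) n y) ^ 2 ∂μ ≤
        C * ((1 / 2 : ℝ) ^ n) ^ (2 * β) := by
  obtain ⟨C, hC0, hC⟩ := hB (√(Fintype.card ι) * 3) (by positivity)
  refine ⟨C, hC0, fun y hy n => ?_⟩
  have hyL (i : ι) : |2 ^ n * y i| ≤ boxSize n - 3 := by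
    have h1 : (1 : ℝ) ≤ 2 ^ n := one_le_pow₀ (by norm_num)
    have h2 : |y i| ≤ 1 := (PiLp.norm_apply_le y i).trans hy
    rw [boxSize_cast, abs_mul, abs_of_nonneg (by positivity : (0 : ℝ) ≤ 2 ^ n)]
    nlinarith
  have h := hC ((1 / 2) ^ n) (by positivity) (pow_le_one₀ (by norm_num) (by norm_num))
    (latticeBox ι (boxSize n)) (fun k => splineAtom n k y) (splineNode n) y
    (fun _ _ => splineAtom_nonneg _ _ _) (sum_splineAtom hyL)
    (sum_splineAtom_smul_splineNode hyL)
    fun k _ hk => norm_splineNode_sub_le_of_splineAtom_ne_zero hk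
  simpa only [quasiInterp, mul_comm] using h

theorem measurable_splineDetail (hm : ∀ y, Measurable (X y)) (n : ℕ) (k : ι → ℤ) :
    Measurable fun ω => splineDetail (fun y => X y ω) n k := by
  unfold splineDetail
  exact (hm _).sub (Finset.measurable_sum _ fun j _ => (hm _).const_mul _)

theorem measurable_quasiInterp (hm : ∀ y, Measurable (X y)) (n : ℕ) (x : EuclideanSpace ℝ ι) :
    Measurable fun ω => quasiInterp (fun y => X y ω) n x := by
  unfold quasiInterp
  exact Finset.measurable_sum _ fun j _ => (hm _).mul_const _

theorem card_latticeBox_boxSize_le (n : ℕ) :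
    ((latticeBox ι (boxSize (n + 1))).card : ℝ) ≤ (32 * 2 ^ n) ^ Fintype.card ι := by
  have hL := five_le_boxSize (n + 1)
  rw [latticeBox, Fintype.card_piFinset, Finset.prod_const, Finset.card_univ, Int.card_Icc]
  push_cast
  gcongr
  have h : ((boxSize (n + 1) + 1 - -boxSize (n + 1)).toNat : ℝ) =
      ((boxSize (n + 1) + 1 - -boxSize (n + 1) : ℤ) : ℝ) := by
    exact_mod_cast Int.toNat_of_nonneg (by lia)
  rw [h]
  push_cast
  rw [boxSize_cast, pow_succ]
  linarith

/-- The normalised details of the field are summable in a high power, almost surely. -/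
theorem HasBarycentricBound.ae_tsum_splineDetail_lt_top (hB : HasBarycentricBound μ X β)
    (hX : IsGaussianProcess X μ) (h0 : ∀ y, ∫ ω, X y ω ∂μ = 0) (hm : ∀ y, Measurable (X y))
    {m : ℕ} (hmβ : (Fintype.card ι + 1 : ℝ) ≤ m * (β - 1)) :
    ∀ᵐ ω ∂μ, ∑' n, ∑ k ∈ latticeBox ι (boxSize (n + 1)),
      ENNReal.ofReal (((((1 / 2 : ℝ) ^ n) ^ ((1 + β) / 2))⁻¹ *
        splineDetail (fun y => X y ω) n k) ^ (2 * m)) < ⊤ := by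
  obtain ⟨C, hC0, hC⟩ := hB.exists_integral_splineDetail_sq_le
  obtain ⟨c, hc, hmom⟩ := exists_lintegral_pow_le_of_hasGaussianLaw μ m
  set N := Fintype.card ι with hN
  have hmeas (n : ℕ) (k : ι → ℤ) : Measurable fun ω =>
      ENNReal.ofReal (((((1 / 2 : ℝ) ^ n) ^ ((1 + β) / 2))⁻¹ *
        splineDetail (fun y => X y ω) n k) ^ (2 * m)) :=
    (((measurable_splineDetail hm n k).const_mul _).pow_const _).ennreal_ofReal
  have hterm (n : ℕ) (k : ι → ℤ) (hk : k ∈ latticeBox ι (boxSize (n + 1))) :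
      ∫⁻ ω, ENNReal.ofReal (((((1 / 2 : ℝ) ^ n) ^ ((1 + β) / 2))⁻¹ *
        splineDetail (fun y => X y ω) n k) ^ (2 * m)) ∂μ ≤
      c * ENNReal.ofReal (C ^ m * ((1 / 2 : ℝ) ^ n) ^ (N + 1)) := by
    set h : ℝ := (1 / 2 : ℝ) ^ n with hh
    have hpos : 0 < h := by positivity
    have hle : h ≤ 1 := pow_le_one₀ (by norm_num) (by norm_num)
    calc _ = ∫⁻ ω, ENNReal.ofReal (((h ^ ((1 + β) / 2))⁻¹) ^ (2 * m)) *
          ENNReal.ofReal (splineDetail (fun y => X y ω) n k ^ (2 * m)) ∂μ := by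
          refine lintegral_congr fun ω => ?_
          rw [mul_pow, ENNReal.ofReal_mul (by positivity)]
      _ = ENNReal.ofReal (((h ^ ((1 + β) / 2))⁻¹) ^ (2 * m)) *
          ∫⁻ ω, ENNReal.ofReal (splineDetail (fun y => X y ω) n k ^ (2 * m)) ∂μ :=
          lintegral_const_mul _ ((measurable_splineDetail hm n k).pow_const _).ennreal_ofReal
      _ ≤ ENNReal.ofReal (((h ^ ((1 + β) / 2))⁻¹) ^ (2 * m)) *
          (c * ENNReal.ofReal ((C * h ^ (2 * β)) ^ m)) := by
          gcongr
          exact hmom _ _ (hasGaussianLaw_sub_sum hX _ _ _ _)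
            (integral_sub_sum_eq_zero hX h0 _ _ _ _) (hC n k hk)
      _ = c * ENNReal.ofReal (((h ^ ((1 + β) / 2))⁻¹) ^ (2 * m) * (C * h ^ (2 * β)) ^ m) := by
          rw [ENNReal.ofReal_mul (by positivity)]; ring
      _ ≤ _ := by
          gcongr c * ENNReal.ofReal ?_
          -- Normalisation costs h^(-m(1+β)) and the moment gives h^(2mβ), which leaves the gain
          -- h^(m(β-1)).
          calc ((h ^ ((1 + β) / 2))⁻¹) ^ (2 * m) * (C * h ^ (2 * β)) ^ m
              = C ^ m * h ^ (m * (β - 1)) := by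
                rw [← Real.rpow_neg hpos.le, mul_pow, ← Real.rpow_mul_natCast hpos.le,
                  ← Real.rpow_mul_natCast hpos.le, mul_left_comm, ← Real.rpow_add hpos]
                congr 2
                push_cast
                ring
            _ ≤ C ^ m * h ^ ((N + 1 : ℕ) : ℝ) := by
                gcongr ?_ * ?_
                refine Real.rpow_le_rpow_of_exponent_ge hpos hle ?_
                push_cast
                exact hmβ
            _ = _ := by rw [Real.rpow_natCast]
  refine ae_lt_top (Measurable.tsum fun n => Finset.measurable_sum _ fun k _ => hmeas n k) ?_
  rw [lintegral_tsum fun n => (Finset.measurable_sum _ fun k _ => hmeas n k).aemeasurable]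
  refine ne_top_of_le_ne_top (b := ∑' n : ℕ, c * ENNReal.ofReal (32 ^ N * C ^ m * (1 / 2) ^ n))
    ?_ (ENNReal.tsum_le_tsum fun n => ?_)
  · rw [ENNReal.tsum_mul_left, ← ENNReal.ofReal_tsum_of_nonneg (fun n => by positivity)
      (summable_geometric_two.mul_left _)]
    exact ENNReal.mul_ne_top hc ENNReal.ofReal_ne_top
  · rw [lintegral_finsetSum _ fun k _ => hmeas n k]
    refine (Finset.sum_le_sum (hterm n)).trans ?_
    rw [Finset.sum_const, nsmul_eq_mul, mul_left_comm, ← ENNReal.ofReal_natCast,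
      ← ENNReal.ofReal_mul (by positivity)]
    gcongr c * ENNReal.ofReal ?_
    -- The O(2^(nN)) nodes consume N of the N + 1 powers of 2^(-n), leaving a convergent geometric
    -- series.
    calc ((latticeBox ι (boxSize (n + 1))).card : ℝ) * (C ^ m * ((1 / 2) ^ n) ^ (N + 1))
        ≤ (32 * 2 ^ n) ^ N * (C ^ m * ((1 / 2) ^ n) ^ (N + 1)) := by
          gcongr
          exact card_latticeBox_boxSize_le n
      _ = 32 ^ N * C ^ m * (1 / 2) ^ n * (2 ^ n * (1 / 2) ^ n) ^ N := by
          ring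
      _ = _ := by rw [← mul_pow]; norm_num

theorem abs_splineDetail_le_of_tsum_lt_top {f : EuclideanSpace ℝ ι → ℝ} {m : ℕ} (hm : m ≠ 0)
    {γ : ℝ} (hW : ∑' n, ∑ k ∈ latticeBox ι (boxSize (n + 1)),
      ENNReal.ofReal (((((1 / 2 : ℝ) ^ n) ^ γ)⁻¹ * splineDetail f n k) ^ (2 * m)) < ⊤) :
    ∃ W : ℝ, 0 ≤ W ∧ ∀ n, ∀ k ∈ latticeBox ι (boxSize (n + 1)),
      |splineDetail f n k| ≤ W * ((1 / 2 : ℝ) ^ n) ^ γ := by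
  set W := ∑' n, ∑ k ∈ latticeBox ι (boxSize (n + 1)),
    ENNReal.ofReal (((((1 / 2 : ℝ) ^ n) ^ γ)⁻¹ * splineDetail f n k) ^ (2 * m)) with hWdef
  -- The constant 1 + W avoids a 2m-th root: if |a| ≥ 1 then |a| ≤ a^(2m) ≤ W.
  refine ⟨1 + W.toReal, by positivity, fun n k hk => ?_⟩
  have hpos : (0 : ℝ) < ((1 / 2 : ℝ) ^ n) ^ γ := by positivity
  set a := (((1 / 2 : ℝ) ^ n) ^ γ)⁻¹ * splineDetail f n k with ha
  have h1 : ENNReal.ofReal (a ^ (2 * m)) ≤ W :=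
    (Finset.single_le_sum (f := fun k => ENNReal.ofReal
      (((((1 / 2 : ℝ) ^ n) ^ γ)⁻¹ * splineDetail f n k) ^ (2 * m)))
      (fun _ _ => zero_le) hk).trans (ENNReal.le_tsum n)
  have h2 : a ^ (2 * m) ≤ W.toReal := (ENNReal.ofReal_le_iff_le_toReal hW.ne).1 h1
  have h3 : |a| ≤ 1 + W.toReal := by
    rcases le_total |a| 1 with h | h
    · linarith [ENNReal.toReal_nonneg (a := W)]
    · have h4 : |a| ≤ |a| ^ (2 * m) := le_self_pow₀ h (by lia)
      rw [Even.pow_abs (even_two_mul m)] at h4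
      linarith
  rw [ha, abs_mul, abs_inv, abs_of_pos hpos, inv_mul_le_iff₀ hpos] at h3
  linarith

/-- By Fatou the lower limit of the squared errors has integral zero, and almost everywhere that
lower limit is (Z - S)². -/
theorem ae_eq_of_tendsto_of_integral_sq_le {Y : ℕ → Ω → ℝ} {Z S : Ω → ℝ}
    (hm : ∀ n, Measurable fun ω => Z ω - Y n ω)
    (hi : ∀ n, Integrable (fun ω => (Z ω - Y n ω) ^ 2) μ) {b : ℕ → ℝ}
    (hb : Tendsto b atTop (𝓝 0)) (hY : ∀ n, ∫ ω, (Z ω - Y n ω) ^ 2 ∂μ ≤ b n)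
    (hS : ∀ᵐ ω ∂μ, Tendsto (fun n => Y n ω) atTop (𝓝 (S ω))) : S =ᵐ[μ] Z := by
  have hmeas (n : ℕ) : Measurable fun ω => ENNReal.ofReal ((Z ω - Y n ω) ^ 2) :=
    ((hm n).pow_const 2).ennreal_ofReal
  have hint (n : ℕ) : ∫⁻ ω, ENNReal.ofReal ((Z ω - Y n ω) ^ 2) ∂μ ≤ ENNReal.ofReal (b n) := by
    rw [← ofReal_integral_eq_lintegral_ofReal (hi n) (Eventually.of_forall fun ω => sq_nonneg _)]
    exact ENNReal.ofReal_le_ofReal (hY n)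
  have hlim : Tendsto (fun n => ∫⁻ ω, ENNReal.ofReal ((Z ω - Y n ω) ^ 2) ∂μ) atTop (𝓝 0) := by
    refine tendsto_of_tendsto_of_tendsto_of_le_of_le tendsto_const_nhds ?_ (fun _ => zero_le) hint
    simpa using ENNReal.tendsto_ofReal hb
  have hzero : ∫⁻ ω, liminf (fun n => ENNReal.ofReal ((Z ω - Y n ω) ^ 2)) atTop ∂μ = 0 :=
    le_antisymm ((lintegral_liminf_le hmeas).trans_eq hlim.liminf_eq) zero_le
  rw [lintegral_eq_zero_iff (Measurable.liminf hmeas)] at hzero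
  filter_upwards [hzero, hS] with ω h1 h2
  have h3 : Tendsto (fun n => ENNReal.ofReal ((Z ω - Y n ω) ^ 2)) atTop
      (𝓝 (ENNReal.ofReal ((Z ω - S ω) ^ 2))) :=
    ENNReal.tendsto_ofReal ((h2.const_sub _).pow 2)
  rw [h3.liminf_eq, Pi.zero_apply, ENNReal.ofReal_eq_zero] at h1
  have h4 : Z ω - S ω = 0 := by
    have := le_antisymm h1 (sq_nonneg _)
    exact pow_eq_zero_iff two_ne_zero |>.1 this
  linarith

/-- A compactly supported centred Gaussian field satisfying a barycentric bound of order `β > 1` has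
a modification with `C^1` sample paths. -/
theorem HasBarycentricBound.exists_contDiff_modification (hB : HasBarycentricBound μ X β)
    (hβ : 1 < β) (hX : IsGaussianProcess X μ) (h0 : ∀ y, ∫ ω, X y ω ∂μ = 0)
    (hm : ∀ y, Measurable (X y)) (hsupp : ∀ y, 2 < ‖y‖ → ∀ ω, X y ω = 0) :
    ∃ S : EuclideanSpace ℝ ι → Ω → ℝ, (∀ y, Measurable (S y)) ∧
      (∀ ω, ContDiff ℝ 1 fun y => S y ω) ∧ ∀ y, ‖y‖ ≤ 1 → S y =ᵐ[μ] X y := by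
  obtain ⟨m, hmβ⟩ := exists_nat_ge ((Fintype.card ι + 1 : ℝ) / (β - 1))
  rw [div_le_iff₀ (by linarith)] at hmβ
  have hm0 : m ≠ 0 := by
    rintro rfl
    have : (0 : ℝ) ≤ Fintype.card ι := by positivity
    norm_num at hmβ
    linarith
  set G : Set Ω := {ω | ∑' n, ∑ k ∈ latticeBox ι (boxSize (n + 1)),
      ENNReal.ofReal (((((1 / 2 : ℝ) ^ n) ^ ((1 + β) / 2))⁻¹ *
        splineDetail (fun y => X y ω) n k) ^ (2 * m)) < ⊤} with hG
  have hGm : MeasurableSet G := by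
    refine measurableSet_lt (Measurable.tsum fun n => Finset.measurable_sum _ fun k _ => ?_)
      measurable_const
    exact (((measurable_splineDetail hm n k).const_mul _).pow_const _).ennreal_ofReal
  have hGae : ∀ᵐ ω ∂μ, ω ∈ G := hB.ae_tsum_splineDetail_lt_top hX h0 hm hmβ
  -- Replacing the approximants by 0 off the measurable full-measure set G makes the limit exist,
  -- and be C¹, for every ω; it is also measurable as a pointwise limit.
  have hex (ω : Ω) : ∃ g : EuclideanSpace ℝ ι → ℝ, ContDiff ℝ 1 g ∧ ∀ x,
      Tendsto (fun n => G.indicator (fun ω => quasiInterp (fun y => X y ω) n x) ω) atTop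
        (𝓝 (g x)) := by
    by_cases hω : ω ∈ G
    · obtain ⟨W, hW0, hW⟩ := abs_splineDetail_le_of_tsum_lt_top hm0 hω
      obtain ⟨g, hg, hlim⟩ := exists_contDiff_tendsto_quasiInterp (fun y hy => hsupp y hy ω)
        (by linarith : 1 < (1 + β) / 2) hW0 hW
      exact ⟨g, hg, fun x => by simpa [hω] using hlim x⟩
    · exact ⟨fun _ => 0, contDiff_const, fun x => by simp [hω]⟩
  choose g hg hlim using hex
  refine ⟨fun y ω => g ω y, fun y => ?_, hg, fun y hy => ?_⟩
  · exact measurable_of_tendsto_metrizable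
      (fun n => (measurable_quasiInterp hm n y).indicator hGm)
      (tendsto_pi_nhds.2 fun ω => hlim ω y)
  · obtain ⟨C, -, hC⟩ := hB.exists_integral_quasiInterp_sub_sq_le
    have hlaw (n : ℕ) : HasGaussianLaw (fun ω => X y ω - quasiInterp (fun y => X y ω) n y) μ := by
      simpa only [quasiInterp, mul_comm] using hasGaussianLaw_sub_sum hX
        (latticeBox ι (boxSize n)) (fun k => splineAtom n k y) (splineNode n) y
    refine ae_eq_of_tendsto_of_integral_sq_le (fun n => (hm y).sub (measurable_quasiInterp hm n y))
      (fun n => (hlaw n).memLp_two.integrable_sq) ?_ (hC y hy) ?_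
    · have h1 : (fun n : ℕ => C * ((1 / 2 : ℝ) ^ n) ^ (2 * β)) =
          fun n : ℕ => C * ((1 / 2 : ℝ) ^ (2 * β)) ^ n := by
        ext n
        rw [← Real.rpow_mul_natCast (by norm_num), ← Real.rpow_natCast,
          ← Real.rpow_mul (by norm_num), mul_comm (n : ℝ)]
      rw [h1, ← mul_zero C]
      exact (tendsto_pow_atTop_nhds_zero_of_lt_one (by positivity)
        (Real.rpow_lt_one (by norm_num) (by norm_num) (by linarith))).const_mul C
    · filter_upwards [hGae] with ω hω
      simpa [hω] using hlim ω y

end GaussianModification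

/-! ### The covariance near the diagonal and second moments of linear combinations. -/

section Covariance

theorem exists_abs_sub_affine_le_of_contDiffOn {f : ℝ → ℝ} (hf : ContDiffOn ℝ 2 f (Icc 0 2)) :
    ∃ A B C : ℝ, 0 ≤ C ∧ ∀ t ∈ Icc (0 : ℝ) 2, |f t - (A + B * t)| ≤ C * t ^ (2 : ℝ) := by
  obtain ⟨C, hC⟩ := exists_taylor_mean_remainder_bound (n := 1) (by norm_num : (0 : ℝ) ≤ 2)
    (by simpa [one_add_one_eq_two] using hf)
  refine ⟨f 0, derivWithin f (Icc 0 2) 0, |C|, abs_nonneg C, fun t ht => ?_⟩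
  have h := hC t ht
  rw [taylorWithinEval_succ, taylor_within_zero_eval] at h
  simp only [Nat.cast_zero, zero_add, Nat.factorial_zero, Nat.cast_one, mul_one, inv_one, sub_zero,
    pow_one, one_mul, iteratedDerivWithin_one, smul_eq_mul, Real.norm_eq_abs, one_add_one_eq_two]
    at h
  rw [Real.rpow_two, mul_comm (derivWithin f (Icc 0 2) 0)]
  exact h.trans (by gcongr; exact le_abs_self C)

/-- Since β < 2, the terms of degree at least two of the polynomial are O(t^β) near 0 and only its
affine part survives. Away from 0 boundedness suffices. -/
theorem exists_abs_sub_affine_le_of_hasPowerExpansion {f : ℝ → ℝ} {β : ℝ} (hβ : 1 < β)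
    (hβ' : β < 2) (hf : ContinuousOn f (Icc 0 2)) (h : HasPowerExpansion f β) :
    ∃ A B C : ℝ, 0 ≤ C ∧ ∀ t ∈ Icc (0 : ℝ) 2, |f t - (A + B * t)| ≤ C * t ^ β := by
  obtain ⟨p, c, hp, -, -⟩ := h
  set q := p.divX.divX with hq
  have hpe (t : ℝ) : p.eval t = p.coeff 0 + p.coeff 1 * t + t ^ 2 * q.eval t := by
    conv_lhs => rw [← p.divX_mul_X_add, ← p.divX.divX_mul_X_add]
    simp only [Polynomial.eval_add, Polynomial.eval_mul, Polynomial.eval_X, Polynomial.eval_C,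
      Polynomial.coeff_divX]
    ring
  set g : ℝ → ℝ := fun t => f t - (p.coeff 0 + p.coeff 1 * t) with hg
  have hgc : ContinuousOn g (Icc 0 2) := hf.sub (by fun_prop)
  obtain ⟨K, hK⟩ := isCompact_Icc.exists_bound_of_continuousOn hgc
  obtain ⟨Q, hQ⟩ := (isCompact_Icc (a := (0 : ℝ)) (b := 2)).exists_bound_of_continuousOn
    q.continuous.continuousOn
  have hK0 : 0 ≤ K := (norm_nonneg _).trans (hK 0 (by norm_num))
  have hQ0 : 0 ≤ Q := (norm_nonneg _).trans (hQ 0 (by norm_num))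
  have hev := hp.bound one_pos
  rw [eventually_nhdsWithin_iff, Metric.eventually_nhds_iff] at hev
  obtain ⟨ε, hε, hev⟩ := hev
  have hsmall (t : ℝ) (ht : 0 < t) (ht1 : t ≤ 1) (htε : t < ε) :
      |g t| ≤ (1 + |c| + Q) * t ^ β := by
    have h1 := hev (y := t) (by rwa [Real.dist_0_eq_abs, abs_of_pos ht]) ht
    have h2 : t ^ 2 ≤ t ^ β := by
      rw [← Real.rpow_two]
      exact Real.rpow_le_rpow_of_exponent_ge ht ht1 hβ'.le
    have h3 := hQ t ⟨ht.le, by linarith⟩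
    have h0 : 0 ≤ t ^ β := by positivity
    rw [Real.norm_eq_abs] at h1 h3
    rw [Real.norm_eq_abs, abs_of_nonneg h0, one_mul, hpe] at h1
    have e : g t = (f t - (p.coeff 0 + p.coeff 1 * t + t ^ 2 * q.eval t + c * t ^ β)) +
        c * t ^ β + t ^ 2 * q.eval t := by rw [hg]; ring
    rw [e]
    refine (abs_add_three _ _ _).trans ?_
    rw [abs_mul, abs_mul, abs_of_nonneg h0, abs_of_nonneg (sq_nonneg t)]
    have h4 : t ^ 2 * |q.eval t| ≤ t ^ β * Q := by gcongr
    linarith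
  -- The expansion says nothing at t = 0 itself; the value there comes from continuity.
  have hg0 : g 0 = 0 := by
    have hmem : (0 : ℝ) ∈ Icc (0 : ℝ) 2 := by norm_num
    have h1 : Tendsto g (𝓝[>] 0) (𝓝 (g 0)) := by
      refine (hgc 0 hmem).mono_left ?_
      rw [← nhdsWithin_Ioc_eq_nhdsGT (by norm_num : (0 : ℝ) < 2)]
      exact nhdsWithin_mono _ Ioc_subset_Icc_self
    have h2 : Tendsto g (𝓝[>] 0) (𝓝 0) := by
      refine squeeze_zero_norm' (a := fun t => (1 + |c| + Q) * t ^ β) ?_ ?_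
      · filter_upwards [Ioo_mem_nhdsGT (lt_min one_pos hε)] with t ht
        exact hsmall t ht.1 (ht.2.le.trans (min_le_left _ _)) (ht.2.trans_le (min_le_right _ _))
      · have h3 : Tendsto (fun t : ℝ => (1 + |c| + Q) * t ^ β) (𝓝 0)
            (𝓝 ((1 + |c| + Q) * 0 ^ β)) :=
          ((Real.continuousAt_rpow_const 0 β (Or.inr (by linarith))).tendsto).const_mul _
        rw [Real.zero_rpow (by linarith), mul_zero] at h3
        exact h3.mono_left nhdsWithin_le_nhds
    exact tendsto_nhds_unique h1 h2
  set δ := min 1 ε / 2 with hδ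
  have hδ0 : 0 < δ := by rw [hδ]; exact half_pos (lt_min one_pos hε)
  have hδ1 : δ < min 1 ε := half_lt_self (lt_min one_pos hε)
  refine ⟨p.coeff 0, p.coeff 1, (1 + |c| + Q) + K / δ ^ β, by positivity, fun t ht => ?_⟩
  change |g t| ≤ _
  rcases ht.1.eq_or_lt with rfl | hpos
  · rw [hg0, abs_zero]; positivity
  · have h0 : 0 ≤ t ^ β := by positivity
    rw [add_mul]
    rcases le_or_gt t δ with h | h
    · refine (hsmall t hpos ((h.trans hδ1.le).trans (min_le_left _ _))
        ((h.trans_lt hδ1).trans_le (min_le_right _ _))).trans (le_add_of_nonneg_right ?_)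
      positivity
    · have h1 : K ≤ K / δ ^ β * t ^ β := by
        rw [div_mul_eq_mul_div, le_div_iff₀ (by positivity)]
        gcongr
      refine ((hK t ht).trans h1).trans (le_add_of_nonneg_left ?_)
      positivity

/-- The covariance function of a field of index `β` is affine near `1`, up to an error of order
`β`. -/
theorem HasCRI.exists_affine_bound {d : ℕ} {Ω : Type*} [MeasurableSpace Ω] {μ : Measure Ω}
    {T : USphere d → Ω → ℝ} {β : ℝ} (hβ : 1 < β) (h : HasCRI μ T β) :
    β ≤ 2 ∧ ∃ κ : ℝ → ℝ, IsCovarianceFunction μ T κ ∧ ∃ A B C : ℝ, 0 ≤ C ∧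
      ∀ t ∈ Icc (0 : ℝ) 2, |κ (1 - t) - (A + B * t)| ≤ C * t ^ β := by
  obtain ⟨κ, hκ, -, h⟩ := h
  have hmaps : MapsTo (fun t : ℝ => 1 - t) (Icc 0 2) (Icc (-1) 1) := fun t ht =>
    ⟨by linarith [ht.2], by linarith [ht.1]⟩
  rcases h with ⟨rfl, h⟩ | ⟨h2, h, -⟩
  · exact ⟨le_rfl, κ, hκ, exists_abs_sub_affine_le_of_contDiffOn
      (h.comp (by fun_prop) hmaps)⟩
  · exact ⟨h2.le, κ, hκ, exists_abs_sub_affine_le_of_hasPowerExpansion hβ h2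
      (hκ.continuousOn.comp (by fun_prop) hmaps) h⟩

/-- The second moment of a finite linear combination of values of the field. -/
theorem integral_sum_sq_le {d : ℕ} {Ω : Type*} [MeasurableSpace Ω] {μ : Measure Ω}
    {T : USphere d → Ω → ℝ} (hT : IsGaussianProcess T μ) {κ : ℝ → ℝ}
    (hκ : IsCovarianceFunction μ T κ) {A B C β : ℝ} (hβ : 0 ≤ β) (hC : 0 ≤ C)
    (hAB : ∀ t ∈ Icc (0 : ℝ) 2, |κ (1 - t) - (A + B * t)| ≤ C * t ^ β)
    {ι : Type*} (I : Finset ι) (a : ι → ℝ) (u : ι → USphere d) {r : ℝ} (hr : 0 ≤ r)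
    (hu : ∀ i ∈ I, ∀ j ∈ I, a i ≠ 0 → a j ≠ 0 →
      ‖(u i : EuclideanSpace ℝ (Fin (d + 1))) - u j‖ ≤ r) :
    ∫ ω, (∑ i ∈ I, a i * T (u i) ω) ^ 2 ∂μ ≤
      |A + B| * (∑ i ∈ I, a i) ^ 2 +
        |B| * ‖∑ i ∈ I, a i • (u i : EuclideanSpace ℝ (Fin (d + 1)))‖ ^ 2 +
        C * (∑ i ∈ I, |a i|) ^ 2 * r ^ (2 * β) := by
  set v : ι → EuclideanSpace ℝ (Fin (d + 1)) := fun i => u i with hv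
  have hv1 (i : ι) : ‖v i‖ = 1 := by simp [hv]
  have hmul (x y : USphere d) : Integrable (fun ω => T x ω * T y ω) μ :=
    (hT.hasGaussianLaw_eval x).memLp_two.integrable_mul (hT.hasGaussianLaw_eval y).memLp_two
  set e : ι → ι → ℝ := fun i j => κ ⟪v i, v j⟫ - (A + B * (1 - ⟪v i, v j⟫)) with he
  have hsq : ∫ ω, (∑ i ∈ I, a i * T (u i) ω) ^ 2 ∂μ =
      ∑ i ∈ I, ∑ j ∈ I, a i * a j * κ ⟪v i, v j⟫ := by
    simp_rw [sq, Finset.sum_mul_sum, mul_mul_mul_comm]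
    rw [integral_finsetSum _ fun i _ => integrable_finsetSum _ fun j _ => (hmul _ _).const_mul _]
    refine Finset.sum_congr rfl fun i _ => ?_
    rw [integral_finsetSum _ fun j _ => (hmul _ _).const_mul _]
    exact Finset.sum_congr rfl fun j _ => by rw [integral_const_mul, hκ.integral_mul]
  have hinner : ‖∑ i ∈ I, a i • v i‖ ^ 2 = ∑ i ∈ I, ∑ j ∈ I, a i * a j * ⟪v i, v j⟫ := by
    rw [← real_inner_self_eq_norm_sq, sum_inner]
    refine Finset.sum_congr rfl fun i _ => ?_
    rw [inner_sum]
    refine Finset.sum_congr rfl fun j _ => ?_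
    rw [real_inner_smul_left, real_inner_smul_right]
    ring
  -- The affine kernel is (A + B) - B⟨u, v⟩, so its quadratic form depends only on Σ aᵢ and Σ aᵢ vᵢ.
  have hdecomp : ∑ i ∈ I, ∑ j ∈ I, a i * a j * κ ⟪v i, v j⟫ =
      (A + B) * (∑ i ∈ I, a i) ^ 2 - B * ‖∑ i ∈ I, a i • v i‖ ^ 2 +
        ∑ i ∈ I, ∑ j ∈ I, a i * a j * e i j := by
    rw [hinner, sq, Finset.sum_mul_sum]
    simp_rw [Finset.mul_sum, ← Finset.sum_sub_distrib, ← Finset.sum_add_distrib]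
    refine Finset.sum_congr rfl fun i _ => Finset.sum_congr rfl fun j _ => ?_
    rw [he]
    ring
  have herr : ∑ i ∈ I, ∑ j ∈ I, a i * a j * e i j ≤ C * (∑ i ∈ I, |a i|) ^ 2 * r ^ (2 * β) := by
    rw [sq, Finset.sum_mul_sum]
    simp_rw [Finset.mul_sum, Finset.sum_mul]
    refine Finset.sum_le_sum fun i hi => Finset.sum_le_sum fun j hj => ?_
    by_cases hai : a i = 0
    · simp [hai]
    by_cases haj : a j = 0
    · simp [haj]
    have hd : ‖v i - v j‖ ^ 2 = 2 * (1 - ⟪v i, v j⟫) := by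
      rw [norm_sub_sq_real, hv1, hv1]; ring
    have hin := abs_le.1 (abs_real_inner_le_norm (v i) (v j))
    rw [hv1, hv1, mul_one] at hin
    have h1 := hAB (1 - ⟪v i, v j⟫) ⟨by linarith [hin.2], by linarith [hin.1]⟩
    rw [sub_sub_cancel] at h1
    have h2 : (1 - ⟪v i, v j⟫ : ℝ) ^ β ≤ r ^ (2 * β) := by
      rw [Real.rpow_mul hr, Real.rpow_two]
      refine Real.rpow_le_rpow (by linarith [hin.2]) ?_ hβ
      have h3 : ‖v i - v j‖ ^ 2 ≤ r ^ 2 := by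
        gcongr
        exact hu i hi j hj hai haj
      nlinarith [sq_nonneg r]
    calc a i * a j * e i j ≤ |a i * a j * e i j| := le_abs_self _
      _ = |a i| * |a j| * |e i j| := by rw [abs_mul, abs_mul]
      _ ≤ |a i| * |a j| * (C * r ^ (2 * β)) := by
          gcongr
          exact h1.trans (by gcongr)
      _ = _ := by ring
  rw [hsq, hdecomp]
  have h1 : (A + B) * (∑ i ∈ I, a i) ^ 2 ≤ |A + B| * (∑ i ∈ I, a i) ^ 2 := by
    gcongr
    exact le_abs_self _
  have h2 : -B * ‖∑ i ∈ I, a i • v i‖ ^ 2 ≤ |B| * ‖∑ i ∈ I, a i • v i‖ ^ 2 := by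
    gcongr
    exact neg_le_abs _
  linarith

/-- Compactly supported `C^2` functions are affine up to a quadratic error. -/
theorem exists_norm_sub_sum_smul_le {E F : Type*} [NormedAddCommGroup E] [NormedSpace ℝ E]
    [NormedAddCommGroup F] [NormedSpace ℝ F] {f : E → F} (hf : ContDiff ℝ 2 f)
    (hc : HasCompactSupport f) : ∃ M : ℝ, 0 ≤ M ∧ ∀ {κ : Type} (s : Finset κ) (w : κ → ℝ) (p : κ → E)
      (y : E) (r : ℝ), (∀ i ∈ s, 0 ≤ w i) → ∑ i ∈ s, w i = 1 → ∑ i ∈ s, w i • p i = y →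
      (∀ i ∈ s, w i ≠ 0 → ‖p i - y‖ ≤ r) → ‖f y - ∑ i ∈ s, w i • f (p i)‖ ≤ M * r ^ 2 := by
  obtain ⟨K, hK⟩ := ContDiff.lipschitzWith_of_hasCompactSupport (hc.fderiv ℝ)
    (hf.fderiv_right (m := 1) (by norm_num [one_add_one_eq_two])) one_ne_zero
  refine ⟨K, K.2, fun s w p y r hw hw1 hwy hr => ?_⟩
  -- The first-order Taylor terms cancel because y is the barycentre; the remainder is controlled by
  -- the Lipschitz constant K of the derivative.
  have hlin : f y - ∑ i ∈ s, w i • f (p i) =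
      -∑ i ∈ s, w i • (f (p i) - f y - fderiv ℝ f y (p i - y)) := by
    have h1 : ∑ i ∈ s, w i • fderiv ℝ f y (p i - y) = 0 := by
      simp_rw [← map_smul, ← map_sum, smul_sub, Finset.sum_sub_distrib, ← Finset.sum_smul]
      rw [hw1, hwy, one_smul, sub_self, map_zero]
    simp_rw [smul_sub, Finset.sum_sub_distrib, ← Finset.sum_smul] at h1 ⊢
    rw [hw1, one_smul, h1]
    abel
  rw [hlin, norm_neg]
  calc ‖∑ i ∈ s, w i • (f (p i) - f y - fderiv ℝ f y (p i - y))‖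
      ≤ ∑ i ∈ s, w i * (K * r ^ 2) := by
        refine norm_sum_le_of_le _ fun i hi => ?_
        rw [norm_smul, Real.norm_of_nonneg (hw i hi)]
        by_cases h0 : w i = 0
        · simp [h0]
        have hpr := hr i hi h0
        have hr0 : 0 ≤ r := (norm_nonneg _).trans hpr
        refine mul_le_mul_of_nonneg_left ?_ (hw i hi)
        have h := (convex_closedBall y r).norm_image_sub_le_of_norm_fderiv_le' (f := f)
          (φ := fderiv ℝ f y) (C := K * r) (x := y) (y := p i) (𝕜 := ℝ)
          (fun x _ => hf.differentiable (by norm_num) x) (fun x hx => ?_)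
          (Metric.mem_closedBall_self hr0) (mem_closedBall_iff_norm.2 hpr)
        · refine h.trans ?_
          rw [sq, ← mul_assoc]
          gcongr
        · refine (hK.norm_sub_le x y).trans ?_
          gcongr
          exact mem_closedBall_iff_norm.1 hx
    _ = K * r ^ 2 := by rw [← Finset.sum_mul, hw1, one_mul]

end Covariance

/-! ### Radial extension from the sphere, and the return to it. -/

section SphereExtension

variable {d : ℕ}

/-- The radial projection onto the sphere, with value `e` at the origin. -/
noncomputable def radialProj (e : USphere d) (y : EuclideanSpace ℝ (Fin (d + 1))) : USphere d :=
  if h : y = 0 then e else ⟨‖y‖⁻¹ • y, by simp [norm_smul, h]⟩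

theorem coe_radialProj {e : USphere d} {y : EuclideanSpace ℝ (Fin (d + 1))} (hy : y ≠ 0) :
    (radialProj e y : EuclideanSpace ℝ (Fin (d + 1))) = ‖y‖⁻¹ • y := by
  rw [radialProj, dif_neg hy]

theorem radialProj_coe (e x : USphere d) : radialProj e x = x := by
  have hx : ‖(x : EuclideanSpace ℝ (Fin (d + 1)))‖ = 1 := by simp
  have h0 : (x : EuclideanSpace ℝ (Fin (d + 1))) ≠ 0 := by
    rw [← norm_ne_zero_iff, hx]; exact one_ne_zero
  ext1
  rw [coe_radialProj h0, hx, inv_one, one_smul]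

/-- A bump function on the real line equal to `1` at `1`. -/
noncomputable def annulusBump : ContDiffBump (1 : ℝ) where
  rIn := 1 / 4
  rOut := 1 / 2
  rIn_pos := by norm_num
  rIn_lt_rOut := by norm_num

/-- A smooth radial cutoff, equal to `1` on the sphere and supported in an annulus. -/
noncomputable def annulusCutoff (y : EuclideanSpace ℝ (Fin (d + 1))) : ℝ := annulusBump (‖y‖ ^ 2)

theorem annulusCutoff_coe (x : USphere d) :
    annulusCutoff (x : EuclideanSpace ℝ (Fin (d + 1))) = 1 := by
  have hx : ‖(x : EuclideanSpace ℝ (Fin (d + 1)))‖ = 1 := by simp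
  rw [annulusCutoff, hx, one_pow]
  exact annulusBump.one_of_mem_closedBall (by simp [annulusBump])

theorem norm_mem_Icc_of_annulusCutoff_ne_zero {y : EuclideanSpace ℝ (Fin (d + 1))}
    (hy : annulusCutoff y ≠ 0) : ‖y‖ ∈ Icc (1 / 2 : ℝ) 2 := by
  have h : ‖y‖ ^ 2 ∈ Function.support annulusBump := hy
  rw [annulusBump.support_eq, Metric.mem_ball, Real.dist_eq, abs_lt] at h
  simp only [annulusBump] at h
  constructor <;> nlinarith [norm_nonneg y, h.1, h.2]

theorem contDiff_annulusCutoff :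
    ContDiff ℝ 2 (annulusCutoff : EuclideanSpace ℝ (Fin (d + 1)) → ℝ) :=
  annulusBump.contDiff.comp (contDiff_norm_sq ℝ)

theorem hasCompactSupport_annulusCutoff :
    HasCompactSupport (annulusCutoff : EuclideanSpace ℝ (Fin (d + 1)) → ℝ) :=
  HasCompactSupport.of_support_subset_isCompact (isCompact_closedBall 0 2) fun _ hy =>
    mem_closedBall_zero_iff.2 (norm_mem_Icc_of_annulusCutoff_ne_zero hy).2

/-- The radial projection, multiplied by a cutoff that makes it smooth. -/
noncomputable def cutoffProj (y : EuclideanSpace ℝ (Fin (d + 1))) : EuclideanSpace ℝ (Fin (d + 1)) :=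
  annulusCutoff y • ‖y‖⁻¹ • y

/-- The arbitrary direction e at the origin is invisible, because the cutoff vanishes there. -/
theorem annulusCutoff_smul_radialProj (e : USphere d) (y : EuclideanSpace ℝ (Fin (d + 1))) :
    annulusCutoff y • (radialProj e y : EuclideanSpace ℝ (Fin (d + 1))) = cutoffProj y := by
  by_cases hy : annulusCutoff y = 0
  · simp [cutoffProj, hy]
  · have h := (norm_mem_Icc_of_annulusCutoff_ne_zero hy).1
    have h0 : y ≠ 0 := by
      rintro rfl
      norm_num at h
    rw [cutoffProj, coe_radialProj h0]

theorem hasCompactSupport_cutoffProj :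
    HasCompactSupport (cutoffProj : EuclideanSpace ℝ (Fin (d + 1)) → _) :=
  hasCompactSupport_annulusCutoff.smul_right

theorem contDiff_cutoffProj :
    ContDiff ℝ 2 (cutoffProj : EuclideanSpace ℝ (Fin (d + 1)) → _) := by
  rw [contDiff_iff_contDiffAt]
  intro y
  by_cases hy : y = 0
  · subst hy
    refine (contDiffAt_const (c := 0)).congr_of_eventuallyEq ?_
    filter_upwards [Metric.ball_mem_nhds (0 : EuclideanSpace ℝ (Fin (d + 1)))
      (by norm_num : (0 : ℝ) < 1 / 2)] with z hz
    have : annulusCutoff z = 0 := by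
      by_contra hne
      have h := (norm_mem_Icc_of_annulusCutoff_ne_zero hne).1
      rw [mem_ball_zero_iff] at hz
      linarith
    simp [cutoffProj, this]
  · exact contDiff_annulusCutoff.contDiffAt.smul
      (((contDiffAt_norm ℝ hy).inv (norm_ne_zero_iff.2 hy)).smul contDiffAt_id)

/-- On the support of the cutoff norms are at least 1/2; the change of direction and the change of
norm each contribute a factor 2. -/
theorem norm_radialProj_sub_le (e : USphere d) {x y : EuclideanSpace ℝ (Fin (d + 1))}
    (hx : annulusCutoff x ≠ 0) (hy : annulusCutoff y ≠ 0) :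
    ‖(radialProj e x : EuclideanSpace ℝ (Fin (d + 1))) - radialProj e y‖ ≤ 4 * ‖x - y‖ := by
  have hx2 := (norm_mem_Icc_of_annulusCutoff_ne_zero hx).1
  have hy2 := (norm_mem_Icc_of_annulusCutoff_ne_zero hy).1
  have hx0 : x ≠ 0 := by rintro rfl; norm_num at hx2
  have hy0 : y ≠ 0 := by rintro rfl; norm_num at hy2
  have hxn : 0 < ‖x‖ := norm_pos_iff.2 hx0
  have hyn : 0 < ‖y‖ := norm_pos_iff.2 hy0
  rw [coe_radialProj hx0, coe_radialProj hy0]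
  have e1 : ‖x‖⁻¹ • x - ‖y‖⁻¹ • y =
      ‖x‖⁻¹ • (x - y) + (‖x‖⁻¹ * (‖y‖ - ‖x‖)) • (‖y‖⁻¹ • y) := by
    rw [mul_sub, inv_mul_cancel₀ hxn.ne', sub_smul, one_smul, smul_smul (‖x‖⁻¹ * ‖y‖), mul_assoc,
      mul_inv_cancel₀ hyn.ne', mul_one, smul_sub]
    abel
  have h1 : ‖‖y‖⁻¹ • y‖ = 1 := by
    rw [norm_smul, norm_inv, norm_norm, inv_mul_cancel₀ hyn.ne']
  have h2 : ‖x‖⁻¹ ≤ 2 := by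
    rw [inv_le_comm₀ hxn two_pos]; linarith
  rw [e1]
  refine (norm_add_le _ _).trans ?_
  rw [norm_smul, norm_smul, h1, mul_one, norm_mul, norm_inv, norm_norm, Real.norm_eq_abs]
  have h3 : |‖y‖ - ‖x‖| ≤ ‖x - y‖ := by
    rw [abs_sub_comm]; exact abs_norm_sub_norm_le x y
  calc ‖x‖⁻¹ * ‖x - y‖ + ‖x‖⁻¹ * |‖y‖ - ‖x‖| ≤ 2 * ‖x - y‖ + 2 * ‖x - y‖ := by gcongr
    _ = 4 * ‖x - y‖ := by ring

theorem abs_annulusCutoff_le_one (y : EuclideanSpace ℝ (Fin (d + 1))) : |annulusCutoff y| ≤ 1 := by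
  rw [annulusCutoff, abs_of_nonneg annulusBump.nonneg]
  exact annulusBump.le_one

/-- The radial extension of a field on the sphere, cut off outside an annulus. -/
noncomputable def radialExtension {Ω : Type*} (e : USphere d) (T : USphere d → Ω → ℝ)
    (y : EuclideanSpace ℝ (Fin (d + 1))) (ω : Ω) : ℝ :=
  annulusCutoff y * T (radialProj e y) ω

variable {Ω : Type*} [MeasurableSpace Ω] {μ : Measure Ω} {T : USphere d → Ω → ℝ} {β : ℝ}

/-- The error is a combination of values of T with coefficients χ(y) and -wᵢ χ(pᵢ). Their sum and
their vector sum are barycentric errors of `annulusCutoff` and `cutoffProj`, both of order h², so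
only the non-affine part of the covariance limits the rate. -/
theorem hasBarycentricBound_radialExtension (hT : IsGaussianProcess T μ) (hβ : 1 < β)
    (h : HasCRI μ T β) (e : USphere d) : HasBarycentricBound μ (radialExtension e T) β := by
  obtain ⟨hβ2, κ, hκ, A, B, C, hC, hAB⟩ := h.exists_affine_bound hβ
  obtain ⟨M, hM0, hM⟩ := exists_norm_sub_sum_smul_le (contDiff_annulusCutoff (d := d))
    hasCompactSupport_annulusCutoff
  obtain ⟨M', hM'0, hM'⟩ := exists_norm_sub_sum_smul_le (contDiff_cutoffProj (d := d))
    hasCompactSupport_cutoffProj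
  intro ρ hρ
  -- The 2 bounds the ℓ¹ norm of the coefficients; the 8 is the Lipschitz constant 4 times the 2ρh
  -- separating any two of the points.
  refine ⟨|A + B| * (M * ρ ^ 2) ^ 2 + |B| * (M' * ρ ^ 2) ^ 2 + C * 2 ^ 2 * (8 * ρ) ^ (2 * β),
    by positivity, fun h hh hh1 s w p y hw hw1 hwy hr => ?_⟩
  set a : Option (Fin (d + 1) → ℤ) → ℝ := fun o =>
    o.elim (annulusCutoff y) fun i => -w i * annulusCutoff (p i) with ha
  set u : Option (Fin (d + 1) → ℤ) → EuclideanSpace ℝ (Fin (d + 1)) := fun o => o.elim y p with hu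
  have hsum (ω : Ω) : radialExtension e T y ω - ∑ i ∈ s, w i * radialExtension e T (p i) ω =
      ∑ o ∈ Finset.insertNone s, a o * T (radialProj e (u o)) ω := by
    simp [Finset.sum_insertNone, ha, hu, radialExtension, sub_eq_add_neg, mul_assoc]
  have hnear : ∀ o ∈ Finset.insertNone s, a o ≠ 0 →
      annulusCutoff (u o) ≠ 0 ∧ ‖u o - y‖ ≤ ρ * h := by
    rintro (_ | i) hi hai
    · exact ⟨hai, by simp only [hu, Option.elim_none, sub_self, norm_zero]; positivity⟩
    · rw [Finset.some_mem_insertNone] at hi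
      exact ⟨right_ne_zero_of_mul hai,
        hr i hi (neg_ne_zero.1 (left_ne_zero_of_mul hai))⟩
  have hdist : ∀ o ∈ Finset.insertNone s, ∀ o' ∈ Finset.insertNone s, a o ≠ 0 → a o' ≠ 0 →
      ‖(radialProj e (u o) : EuclideanSpace ℝ (Fin (d + 1))) - radialProj e (u o')‖ ≤
        8 * ρ * h := by
    intro o ho o' ho' hao hao'
    obtain ⟨h1, h2⟩ := hnear o ho hao
    obtain ⟨h1', h2'⟩ := hnear o' ho' hao'
    refine (norm_radialProj_sub_le e h1 h1').trans ?_
    have h3 : ‖u o - u o'‖ ≤ ‖u o - y‖ + ‖u o' - y‖ := by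
      rw [norm_sub_rev (u o') y]; exact norm_sub_le_norm_sub_add_norm_sub _ _ _
    linarith
  have hmain := integral_sum_sq_le hT hκ (by linarith : 0 ≤ β) hC hAB (Finset.insertNone s) a
    (fun o => radialProj e (u o)) (by positivity : 0 ≤ 8 * ρ * h) hdist
  have hA1 : (∑ o ∈ Finset.insertNone s, a o) ^ 2 ≤ (M * (ρ * h) ^ 2) ^ 2 := by
    have h1 : ∑ o ∈ Finset.insertNone s, a o =
        annulusCutoff y - ∑ i ∈ s, w i • annulusCutoff (p i) := by
      simp [Finset.sum_insertNone, ha, sub_eq_add_neg]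
    rw [h1, ← sq_abs, ← Real.norm_eq_abs]
    gcongr
    exact hM s w p y _ hw hw1 hwy hr
  have hA2 : ‖∑ o ∈ Finset.insertNone s,
      a o • (radialProj e (u o) : EuclideanSpace ℝ (Fin (d + 1)))‖ ^ 2 ≤
        (M' * (ρ * h) ^ 2) ^ 2 := by
    have h1 : ∑ o ∈ Finset.insertNone s,
        a o • (radialProj e (u o) : EuclideanSpace ℝ (Fin (d + 1))) =
        cutoffProj y - ∑ i ∈ s, w i • cutoffProj (p i) := by
      simp [Finset.sum_insertNone, ha, hu, sub_eq_add_neg, mul_smul,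
        annulusCutoff_smul_radialProj]
    rw [h1]
    gcongr
    exact hM' s w p y _ hw hw1 hwy hr
  have hA3 : ∑ o ∈ Finset.insertNone s, |a o| ≤ 2 := by
    rw [Finset.sum_insertNone]
    have h1 : ∑ i ∈ s, |a (some i)| ≤ ∑ i ∈ s, w i := by
      refine Finset.sum_le_sum fun i hi => ?_
      simp only [ha, Option.elim_some]
      rw [abs_mul, abs_neg, abs_of_nonneg (hw i hi)]
      exact mul_le_of_le_one_right (hw i hi) (abs_annulusCutoff_le_one _)
    have h2 : |a none| ≤ 1 := abs_annulusCutoff_le_one y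
    linarith
  -- This is where β ≤ 2 is needed.
  have h4 : h ^ 4 ≤ h ^ (2 * β) := by
    rw [← Real.rpow_natCast h 4]
    exact Real.rpow_le_rpow_of_exponent_ge hh hh1 (by push_cast; linarith)
  simp_rw [hsum]
  refine hmain.trans ?_
  calc |A + B| * (∑ o ∈ Finset.insertNone s, a o) ^ 2 +
        |B| * ‖∑ o ∈ Finset.insertNone s,
          a o • (radialProj e (u o) : EuclideanSpace ℝ (Fin (d + 1)))‖ ^ 2 +
        C * (∑ o ∈ Finset.insertNone s, |a o|) ^ 2 * (8 * ρ * h) ^ (2 * β)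
      ≤ |A + B| * (M * (ρ * h) ^ 2) ^ 2 + |B| * (M' * (ρ * h) ^ 2) ^ 2 +
        C * 2 ^ 2 * (8 * ρ * h) ^ (2 * β) := by gcongr
    _ = (|A + B| * (M * ρ ^ 2) ^ 2 + |B| * (M' * ρ ^ 2) ^ 2) * h ^ 4 +
        C * 2 ^ 2 * (8 * ρ) ^ (2 * β) * h ^ (2 * β) := by
        rw [Real.mul_rpow (by positivity) hh.le]; ring
    _ ≤ (|A + B| * (M * ρ ^ 2) ^ 2 + |B| * (M' * ρ ^ 2) ^ 2) * h ^ (2 * β) +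
        C * 2 ^ 2 * (8 * ρ) ^ (2 * β) * h ^ (2 * β) := by gcongr
    _ = _ := by ring

/-- A field of covariance regularity index `β > 1` whose values are measurable has a modification
with `C^1` sample paths. -/
theorem exists_isC1OnSphere_modification_of_measurable (hT : IsGaussianProcess T μ)
    (h0 : ∀ x, ∫ ω, T x ω ∂μ = 0) (hm : ∀ x, Measurable (T x)) (hβ : 1 < β)
    (h : HasCRI μ T β) :
    ∃ S : USphere d → Ω → ℝ, (∀ x, Measurable (S x)) ∧ (∀ x, S x =ᵐ[μ] T x) ∧
      ∀ ω, IsC1OnSphere fun x => S x ω := by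
  set e : USphere d := ⟨EuclideanSpace.single 0 1, by simp⟩
  obtain ⟨S, hSm, hS1, hST⟩ := (hasBarycentricBound_radialExtension hT hβ h
    e).exists_contDiff_modification hβ ((hT.comp_right (radialProj e)).smul annulusCutoff)
    (fun y => by simp [radialExtension, integral_const_mul, h0])
    (fun y => (hm _).const_mul _) fun y hy ω => by
      have : annulusCutoff y = 0 := by
        by_contra hne
        linarith [(norm_mem_Icc_of_annulusCutoff_ne_zero hne).2]
      simp [radialExtension, this]
  refine ⟨fun x => S x, fun x => hSm x, fun x => ?_, fun ω => ?_⟩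
  · refine (hST x (by simp)).trans (Eventually.of_forall fun ω => ?_)
    simp [radialExtension, annulusCutoff_coe, radialProj_coe]
  · have := Fact.mk (finrank_euclideanSpace_fin (𝕜 := ℝ) (n := d + 1))
    exact (hS1 ω).contMDiff.comp contMDiff_coe_sphere

/-- Each T x may be replaced by a measurable version: Gaussianity, means and the index condition
depend only on the almost-everywhere classes. -/
theorem exists_isC1OnSphere_modification (hT : IsGaussianProcess T μ)
    (h0 : ∀ x, ∫ ω, T x ω ∂μ = 0) (hβ : 1 < β) (h : HasCRI μ T β) :
    ∃ S : USphere d → Ω → ℝ, (∀ x, Measurable (S x)) ∧ (∀ x, S x =ᵐ[μ] T x) ∧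
      ∀ ω, IsC1OnSphere fun x => S x ω := by
  set T' : USphere d → Ω → ℝ := fun x => (hT.aemeasurable x).mk (T x) with hT'
  have hTT' (x : USphere d) : T x =ᵐ[μ] T' x := (hT.aemeasurable x).ae_eq_mk
  have hcri : HasCRI μ T' β := by
    obtain ⟨κ, hκ, hrest⟩ := h
    refine ⟨κ, ⟨hκ.continuousOn, fun x y => ?_⟩, hrest⟩
    rw [← hκ.integral_mul]
    exact integral_congr_ae ((hTT' x).symm.mul (hTT' y).symm)
  obtain ⟨S, hSm, hST, hS1⟩ := exists_isC1OnSphere_modification_of_measurable (hT.congr hTT')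
    (fun x => (integral_congr_ae (hTT' x).symm).trans (h0 x))
    (fun x => (hT.aemeasurable x).measurable_mk) hβ hcri
  exact ⟨S, hSm, fun x => (hST x).trans (hTT' x).symm, hS1⟩

/-- A separable field agrees everywhere with any continuous modification, almost surely. -/
theorem IsSeparableField.ae_forall_eq_of_continuous (hT : IsSeparableField μ T)
    {S : USphere d → Ω → ℝ} (hST : ∀ x, S x =ᵐ[μ] T x) (hS : ∀ ω, Continuous fun x => S x ω) :
    ∀ᵐ ω ∂μ, ∀ x, T x ω = S x ω := by
  obtain ⟨D, hD, hcl⟩ := hT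
  have hDae : ∀ᵐ ω ∂μ, ∀ y ∈ D, S y ω = T y ω := (ae_ball_iff hD).2 fun y _ => hST y
  filter_upwards [hcl, hDae] with ω h1 h2 x
  -- The graph of the continuous path of S is closed and contains the graph of T over D, hence its
  -- closure.
  have hclosed : IsClosed {z : USphere d × ℝ | z.2 = S z.1 ω} :=
    isClosed_eq continuous_snd ((hS ω).comp continuous_fst)
  refine closure_minimal ?_ hclosed (h1 x)
  rintro _ ⟨y, hy, rfl⟩
  exact (h2 y hy).symm

end SphereExtension

theorem proposition3p3 {d : ℕ} (hd : 1 ≤ d) {Ω : Type*} [MeasurableSpace Ω]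
    (μ : Measure Ω) [IsProbabilityMeasure μ] (T : USphere d → Ω → ℝ)
    (hGauss : IsGaussianProcess T μ) (hIso : IsIsotropic μ T)
    (hMean : ∀ x, ∫ ω, T x ω ∂μ = 0) (hVar : ∀ x, variance (T x) μ = 1)
    (hCRI : ∃ β : ℝ, 1 < β ∧ HasCRI μ T β) :
    (∃ S : USphere d → Ω → ℝ, (∀ x, Measurable (S x)) ∧ (∀ x, S x =ᵐ[μ] T x) ∧
      ∀ ω, IsC1OnSphere (fun x => S x ω)) ∧
    (IsSeparableField μ T → ∀ᵐ ω ∂μ, IsC1OnSphere (fun x => T x ω)) := by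
  obtain ⟨β, hβ, h⟩ := hCRI
  obtain ⟨S, hSm, hST, hS1⟩ := exists_isC1OnSphere_modification hGauss hMean hβ h
  refine ⟨⟨S, hSm, hST, hS1⟩, fun hsep => ?_⟩
  filter_upwards [hsep.ae_forall_eq_of_continuous hST fun ω => (hS1 ω).continuous] with ω hω
  have : (fun x => T x ω) = fun x => S x ω := funext hω
  rw [this]
  exact hS1 ω
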